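/- Let $d\ge 3$. For a dyadic interval $I=[m2^{-s},(m+1)2^{-s})$ let $h_I=-\mathbf 1_{I_{\rm left}}+\mathbf 1_{I_{\rm right}}$ be its $L^\infty$-normalized Haar function, and for a dyadic rectangle $R=R_1\times\cdots\times R_d\subset[0,1)^d$ let $h_R(x)=\prod_{k=1}^d h_{R_k}(x_k)$. For $n\ge 1$ let $\mathbb H_n$ be the set of $\vec r=(r_1,\dots,r_d)$ with nonnegative integer entries and $r_1+\cdots+r_d=n$. Given real coefficients $\alpha(R)$, put $$f_{\vec r}=\sum_{R\subset[0,1)^d:\ |R_k|=2^{-r_k}\ \forall k}\operatorname{sgn}(\alpha(R))\,h_R .$$ Let $0<\varepsilon<1$, $0<a\le 1$, $q=\lfloor a n^{\varepsilon}\rfloor$ and $\rho=\sqrt q\,n^{-(d-1)/2}$. Divide $\{1,\dots,n\}$ into $q$ consecutive disjoint intervals of integers $I_1,\dots,I_q$ of equal length (up to integer rounding: any two lengths differ by at most one), and set $$\mathbb A_t=\{\vec r\in\mathbb H_n: r_1\in I_t\},\qquad F_t=\sum_{\vec r\in\mathbb A_t}f_{\vec r}.$$ Let $\mathbb P$ be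 Lebesgue measure on $[0,1]^d$ and $\|\cdot\|_p$ the norm of $L^p([0,1]^d)$. **Theorem.** There are constants $0<c<1$ and $C>0$, depending only on $d$, such that for all $\varepsilon$, $a$, $n$, $\alpha$ and $I_1,\dots,I_q$ as above and all $1\le t\le q$, $$\|\rho F_t\|_p\le C\sqrt p\qquad\text{for all real } 1\le p\le c\,n^{\frac{1-2\varepsilon}{2d-1}},$$ and consequently $$\mathbb P\bigl(|\rho F_t|>x\bigr)\le C\exp(-c x^2)\qquad\text{for all } 0\le x< c\,n^{\frac{1-2\varepsilon}{4d-2}}.$$ -/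

import Mathlib

open MeasureTheory

noncomputable section

namespace SmallBall

/-- The `L^∞`-normalized Haar function `-𝟙_{left half} + 𝟙_{right half}` of the dyadic interval
`I = [m 2⁻ˢ, (m + 1) 2⁻ˢ)`. -/
def haarInterval (s m : ℕ) (x : ℝ) : ℝ :=
  -(Set.Ico ((m : ℝ) / 2 ^ s) (((m : ℝ) + 1 / 2) / 2 ^ s)).indicator (fun _ => (1 : ℝ)) x
    + (Set.Ico (((m : ℝ) + 1 / 2) / 2 ^ s) (((m : ℝ) + 1) / 2 ^ s)).indicator
        (fun _ => (1 : ℝ)) x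

/-- A dyadic rectangle `R = R_1 × ⋯ × R_d` contained in the unit cube: its `k`-th side is the
dyadic interval `[pos k * 2 ^ (-level k), (pos k + 1) * 2 ^ (-level k))`. -/
structure DyadicRect (d : ℕ) where
  level : Fin d → ℕ
  pos : (k : Fin d) → Fin (2 ^ level k)

/-- The Haar function `h_R(x) = ∏ₖ h_{R_k}(x_k)` of a dyadic rectangle. -/
def haar {d : ℕ} (R : DyadicRect d) (x : Fin d → ℝ) : ℝ :=
  ∏ k, haarInterval (R.level k) (R.pos k) (x k)

/-- `f_r = ∑_{R ∈ 𝓡_r} sgn (α R) h_R`, the sum over all dyadic rectangles `R` in the unit cube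
with `|R_k| = 2 ^ (-r_k)` for every `k`. -/
def rFun {d : ℕ} (α : DyadicRect d → ℝ) (r : Fin d → ℕ) (x : Fin d → ℝ) : ℝ :=
  ∑ m : (k : Fin d) → Fin (2 ^ r k), Real.sign (α ⟨r, m⟩) * haar ⟨r, m⟩ x

/-- `ℍ_n`: the vectors of `d` nonnegative integers with sum `n`. -/
def hyperbolic (d n : ℕ) : Finset (Fin d → ℕ) :=
  Finset.Nat.antidiagonalTuple d n

/-- The number of blocks, `q = ⌊a n^ε⌋`. -/
def blockCount (a ε : ℝ) (n : ℕ) : ℕ := ⌊a * (n : ℝ) ^ ε⌋₊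

/-- The normalization `ρ = √q n^{-(d-1)/2}`. -/
def rho (d n q : ℕ) : ℝ := √(q : ℝ) * (n : ℝ) ^ (-(((d : ℝ) - 1) / 2))

/-- `0 = e 0 ≤ e 1 ≤ ⋯ ≤ e q = n` are the cut points of a division of `{1, …, n}` into the `q`
consecutive disjoint intervals of integers `(e t, e (t + 1)]`, `t < q`, which have equal length
as far as integrality permits: any two lengths differ by at most one. (If `q ∣ n`, then all the
lengths are equal to `n / q`.) -/
structure IsEqualDivision (n q : ℕ) (e : ℕ → ℕ) : Prop where
  first : e 0 = 0
  last : e q = n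
  mono : ∀ t < q, e t ≤ e (t + 1)
  balanced : ∀ s < q, ∀ t < q, e (s + 1) - e s ≤ (e (t + 1) - e t) + 1

/-- `𝔸 = {r ∈ ℍ_n : r_1 ∈ I}` for a finite set `I` of integers; the first coordinate is the one
with index `0`. -/
def block (d n : ℕ) [NeZero d] (I : Finset ℕ) : Finset (Fin d → ℕ) :=
  (hyperbolic d n).filter (fun r => r 0 ∈ I)

/-- `F = ∑_{r ∈ 𝔸} f_r`, where `𝔸 = {r ∈ ℍ_n : r_1 ∈ I}`. -/
def blockSum {d : ℕ} [NeZero d] (n : ℕ) (α : DyadicRect d → ℝ) (I : Finset ℕ)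
    (x : Fin d → ℝ) : ℝ :=
  ∑ r ∈ block d n I, rFun α r x

/-- The probability measure of the setting: Lebesgue measure on the unit cube `[0,1]^d`. -/
def cubeMeasure (d : ℕ) : Measure (Fin d → ℝ) :=
  volume.restrict (Set.Icc 0 1)

end SmallBall

end

/-! On dyadic scale `2^-L` the cube is a finite uniform probability space of binary digits. Flipping
digit `r k` of coordinate `k` changes the sign of `f_r`, and flipping a later digit of that
coordinate leaves `f_r` fixed. So `f_r` is a conditionally symmetric martingale difference in every
coordinate separately (`IsRFamily`).

Let `squareFun f s k` be the sum, over all values of the first `k` coordinates, of the square of the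
corresponding partial sum of the `f_r`. For `k = 0` it is `F_t^2`. For `k = d - 1` each partial sum
has at most one term, because the entries of `r` sum to `n`, so it is at most `T = m (n+1)^(d-2)`,
where `m = 2(n+1)/q` bounds the block length. The proof descends from `d - 1` to `0`. Scalar square
function estimates would cost a factor `p` at every step, whereas `√p` allows only one such factor
in all.

The remedy is to treat the partial sums as one martingale `M` in a finite-dimensional Hilbert space,
with square function `V` and bracket matrix `∑ D_b D_bᵀ`. In `MomentLE.sum_sq_of_flipDiff` the
factor `p` multiplies only the Hilbert-Schmidt norm of the bracket; its trace `V` enters with the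
factor 2. To prove this, `M` is paired with a Gaussian vector `g`. For fixed `g` the scalar
exponential inequality applies, and averaging over `g` with Jensen's inequality recovers `‖M‖^2`,
provided that the bracket is small.

For `k ≥ 1` the Hilbert-Schmidt norm is much smaller than `T`. A bracket entry belongs to two
prefixes `J`, `J'`. If their sums differ and all coordinates strictly between the `k`-th and the
last are frozen, then paired indices have different last coordinates, so the entry is itself a
martingale in the last coordinate (`moment_cell_inner`). Pairs with equal sums are rare. The frozen
coordinates are released one at a time by a type 2 inequality for the Schatten 4-norm
(`MomentLE.gramNorm_of_flipDiff`).

The resulting error relative to `T` is `p^(d-2) √(pq/(n+1))`, which the restriction on `p` makes at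
most 1. Only the step to `k = 0`, where the bracket is a scalar, costs a factor `p`. Hence
`‖F_t‖_{2p}^2 ≲ p T`, and Chebyshev's inequality with optimized `p` gives the Gaussian tail. -/

open MeasureTheory

noncomputable section

namespace SmallBall

open Finset ProbabilityTheory
open scoped BigOperators

/-! ### Moment bounds on a finite probability space -/

section Moment

variable {Ω : Type*} [Fintype Ω]

/-- The nonnegative function `φ` has `k`-th moment at most `A ^ k` for the uniform measure. -/
structure MomentLE (φ : Ω → ℝ) (k : ℕ) (A : ℝ) : Prop where
  nonneg : ∀ ω, 0 ≤ φ ω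
  bound_nonneg : 0 ≤ A
  expect_le : 𝔼 ω, φ ω ^ k ≤ A ^ k

namespace MomentLE

variable {φ ψ : Ω → ℝ} {k : ℕ} {A B : ℝ}

lemma mono (h : MomentLE ψ k A) (h0 : ∀ ω, 0 ≤ φ ω) (h1 : ∀ ω, φ ω ≤ ψ ω) (hAB : A ≤ B) :
    MomentLE φ k B :=
  ⟨h0, h.bound_nonneg.trans hAB,
    (expect_le_expect fun ω _ => pow_le_pow_left₀ (h0 ω) (h1 ω) k).trans
      (h.expect_le.trans (pow_le_pow_left₀ h.bound_nonneg hAB k))⟩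

lemma of_le [Nonempty Ω] (h0 : ∀ ω, 0 ≤ φ ω) (h1 : ∀ ω, φ ω ≤ A) (k : ℕ) : MomentLE φ k A :=
  have hA : 0 ≤ A := (h0 (Classical.arbitrary Ω)).trans (h1 _)
  ⟨h0, hA, (expect_le_expect fun ω _ => pow_le_pow_left₀ (h0 ω) (h1 ω) k).trans
    (by rw [Fintype.expect_const])⟩

lemma const_mul (h : MomentLE φ k A) {c : ℝ} (hc : 0 ≤ c) :
    MomentLE (fun ω => c * φ ω) k (c * A) :=
  ⟨fun ω => mul_nonneg hc (h.nonneg ω), mul_nonneg hc h.bound_nonneg, by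
    simp only [mul_pow, ← mul_expect]
    exact mul_le_mul_of_nonneg_left h.expect_le (by positivity)⟩

lemma eq_zero (h : MomentLE φ k 0) (hk : k ≠ 0) (ω : Ω) : φ ω = 0 := by
  have h1 := h.expect_le
  rw [zero_pow hk, Fintype.expect_eq_sum_div_card] at h1
  have : Nonempty Ω := ⟨ω⟩
  have hc : (0 : ℝ) < Fintype.card Ω := by exact_mod_cast Fintype.card_pos
  have h2 : ∑ ω, φ ω ^ k ≤ 0 := by
    by_contra hcon
    exact absurd h1 (not_le.2 (div_pos (not_le.1 hcon) hc))
  have h3 := (sum_eq_zero_iff_of_nonneg (fun ω _ => pow_nonneg (h.nonneg ω) k)).1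
    (le_antisymm h2 (sum_nonneg fun ω _ => pow_nonneg (h.nonneg ω) k)) ω (mem_univ ω)
  exact eq_zero_of_pow_eq_zero h3

/-- Minkowski's inequality in `L^k`: `(φ + ψ)/(A + B)` is the convex combination of `φ/A` and `ψ/B`
with weights `A/(A+B)` and `B/(A+B)`, and `x ↦ x^k` is convex. -/
lemma add (hφ : MomentLE φ k A) (hψ : MomentLE ψ k B) (hk : k ≠ 0) :
    MomentLE (fun ω => φ ω + ψ ω) k (A + B) := by
  have hA := hφ.bound_nonneg
  have hB := hψ.bound_nonneg
  refine ⟨fun ω => add_nonneg (hφ.nonneg ω) (hψ.nonneg ω), add_nonneg hA hB, ?_⟩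
  rcases hA.eq_or_lt with rfl | hA'
  · simpa [hφ.eq_zero hk] using hψ.expect_le
  rcases hB.eq_or_lt with rfl | hB'
  · simpa [hψ.eq_zero hk] using hφ.expect_le
  have key : ∀ ω, (φ ω + ψ ω) ^ k ≤ (A + B) ^ k *
      (A / (A + B) * (φ ω ^ k / A ^ k) + B / (A + B) * (ψ ω ^ k / B ^ k)) := by
    intro ω
    have h1 := (convexOn_pow (𝕜 := ℝ) k).2
      (Set.mem_Ici.2 (div_nonneg (hφ.nonneg ω) hA)) (Set.mem_Ici.2 (div_nonneg (hψ.nonneg ω) hB))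
      (show 0 ≤ A / (A + B) by positivity) (show 0 ≤ B / (A + B) by positivity) (by field_simp)
    simp only [smul_eq_mul, div_pow] at h1
    refine le_trans (le_of_eq ?_) (mul_le_mul_of_nonneg_left h1 (by positivity))
    rw [← mul_pow]
    congr 1
    field_simp
  refine (expect_le_expect fun ω _ => key ω).trans ?_
  rw [← mul_expect, expect_add_distrib, ← mul_expect, ← mul_expect, ← expect_div, ← expect_div]
  have h1 : (𝔼 ω, φ ω ^ k) / A ^ k ≤ 1 := div_le_one_of_le₀ hφ.expect_le (by positivity)
  have h2 : (𝔼 ω, ψ ω ^ k) / B ^ k ≤ 1 := div_le_one_of_le₀ hψ.expect_le (by positivity)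
  calc _ ≤ (A + B) ^ k * (A / (A + B) * 1 + B / (A + B) * 1) := by gcongr
    _ = (A + B) ^ k := by rw [show A / (A + B) * 1 + B / (A + B) * 1 = 1 by field_simp, mul_one]

lemma sum {ι : Type*} {s : Finset ι} {φ : ι → Ω → ℝ} {A : ι → ℝ} (hk : k ≠ 0)
    (h : ∀ i ∈ s, MomentLE (φ i) k (A i)) :
    MomentLE (fun ω => ∑ i ∈ s, φ i ω) k (∑ i ∈ s, A i) := by
  classical
  induction s using Finset.induction_on with
  | empty => exact ⟨by simp, by simp, by simp [hk]⟩
  | insert i s hi ih =>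
    simp only [sum_insert hi]
    exact (h i (mem_insert_self i s)).add (ih fun j hj => h j (mem_insert_of_mem hj)) hk

lemma of_pow {j : ℕ} (h : MomentLE (fun ω => φ ω ^ j) k (A ^ j)) (h0 : ∀ ω, 0 ≤ φ ω)
    (hA : 0 ≤ A) : MomentLE φ (j * k) A :=
  ⟨h0, hA, by simpa only [← pow_mul] using h.expect_le⟩

end MomentLE

end Moment

/-! ### Gaussian averages -/

section Gaussian

lemma integrable_exp_tilt (a : ℝ) (j : ℕ) :
    Integrable (fun x : ℝ => x ^ j * Real.exp (a * x)) (gaussianReal 0 1) := by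
  have h := integrable_pow_mul_exp_of_mem_interior_integrableExpSet (X := id)
    (μ := gaussianReal 0 1) (v := a) (by simp) j
  simpa using h

/-- The one-dimensional Cameron-Martin formula, by completing the square in the density. -/
lemma integral_mul_exp_tilt (a : ℝ) (φ : ℝ → ℝ) :
    ∫ x, φ x * Real.exp (a * x - a ^ 2 / 2) ∂(gaussianReal 0 1) = ∫ x, φ x ∂(gaussianReal a 1) := by
  rw [integral_gaussianReal_eq_integral_smul one_ne_zero,
    integral_gaussianReal_eq_integral_smul one_ne_zero]
  congr 1 with x
  simp only [gaussianPDFReal, smul_eq_mul, NNReal.coe_one, mul_one, sub_zero]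
  have : Real.exp (-(x - a) ^ 2 / 2) =
      Real.exp (-x ^ 2 / 2) * Real.exp (a * x - a ^ 2 / 2) := by
    rw [← Real.exp_add]; congr 1; ring
  rw [this]; ring

lemma integral_exp_tilt_zero (a : ℝ) :
    ∫ x, Real.exp (a * x - a ^ 2 / 2) ∂(gaussianReal 0 1) = 1 := by
  simpa using integral_mul_exp_tilt a fun _ => 1

lemma integral_exp_tilt_one (a : ℝ) :
    ∫ x, x * Real.exp (a * x - a ^ 2 / 2) ∂(gaussianReal 0 1) = a :=
  (integral_mul_exp_tilt a fun x => x).trans integral_id_gaussianReal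

lemma integral_exp_tilt_two (a : ℝ) :
    ∫ x, x ^ 2 * Real.exp (a * x - a ^ 2 / 2) ∂(gaussianReal 0 1) = a ^ 2 + 1 := by
  have h := variance_eq_sub (memLp_id_gaussianReal' (μ := a) (v := 1) 2 (by simp))
  rw [variance_id_gaussianReal] at h
  simp only [Pi.pow_apply, id, integral_id_gaussianReal, NNReal.coe_one] at h
  rw [integral_mul_exp_tilt a fun x => x ^ 2]
  linarith

variable {ι : Type*} [Fintype ι]

/-- The standard Gaussian measure on `ι → ℝ`. -/
abbrev gaussianPi (ι : Type*) [Fintype ι] : Measure (ι → ℝ) :=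
  Measure.pi fun _ => gaussianReal 0 1

/-- The density of the Gaussian measure with mean `a` with respect to the standard one. -/
def gaussianTilt (a g : ι → ℝ) : ℝ := ∏ i, Real.exp (a i * g i - a i ^ 2 / 2)

lemma gaussianTilt_eq (a g : ι → ℝ) :
    gaussianTilt a g = Real.exp (∑ i, a i * g i - (∑ i, a i ^ 2) / 2) := by
  rw [gaussianTilt, ← Real.exp_sum, sum_sub_distrib, sum_div]

lemma integrable_exp_tilt' (a : ℝ) (j : ℕ) :
    Integrable (fun x : ℝ => x ^ j * Real.exp (a * x - a ^ 2 / 2)) (gaussianReal 0 1) := by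
  simp only [sub_eq_add_neg, Real.exp_add, ← mul_assoc]
  exact (integrable_exp_tilt a j).mul_const _

lemma integral_gaussianTilt (a : ι → ℝ) :
    Integrable (gaussianTilt a) (gaussianPi ι) ∧ ∫ g, gaussianTilt a g ∂(gaussianPi ι) = 1 := by
  constructor
  · exact Integrable.fintype_prod fun i => by simpa using integrable_exp_tilt' (a i) 0
  · simp only [gaussianTilt]
    rw [integral_fintype_prod_eq_prod (fun i x => Real.exp (a i * x - a i ^ 2 / 2))]
    simp [integral_exp_tilt_zero]

lemma integral_apply_mul_gaussianTilt (a : ι → ℝ) (i : ι) :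
    Integrable (fun g => g i * gaussianTilt a g) (gaussianPi ι) ∧
      ∫ g, g i * gaussianTilt a g ∂(gaussianPi ι) = a i := by
  classical
  have h : ∀ g : ι → ℝ, g i * gaussianTilt a g =
      ∏ l, (g l ^ (if l = i then 1 else 0) * Real.exp (a l * g l - a l ^ 2 / 2)) := by
    intro g
    rw [prod_mul_distrib, gaussianTilt]
    simp [pow_ite]
  simp only [h]
  constructor
  · exact Integrable.fintype_prod fun l => integrable_exp_tilt' (a l) _
  · rw [integral_fintype_prod_eq_prod
      (fun l x => x ^ (if l = i then 1 else 0) * Real.exp (a l * x - a l ^ 2 / 2)),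
      prod_eq_single i]
    · simp [integral_exp_tilt_one]
    · intro l _ hl
      simp [hl, integral_exp_tilt_zero]
    · simp

lemma integral_apply_mul_apply_mul_gaussianTilt [DecidableEq ι] (a : ι → ℝ) (i j : ι) :
    Integrable (fun g => g i * g j * gaussianTilt a g) (gaussianPi ι) ∧
      ∫ g, g i * g j * gaussianTilt a g ∂(gaussianPi ι) =
        a i * a j + if i = j then 1 else 0 := by
  have h : ∀ g : ι → ℝ, g i * g j * gaussianTilt a g =
      ∏ l, (g l ^ ((if l = i then 1 else 0) + (if l = j then 1 else 0)) *
        Real.exp (a l * g l - a l ^ 2 / 2)) := by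
    intro g
    rw [prod_mul_distrib, gaussianTilt]
    simp only [pow_add, prod_mul_distrib]
    simp [pow_ite]
  simp only [h]
  constructor
  · exact Integrable.fintype_prod fun l => integrable_exp_tilt' (a l) _
  · rw [integral_fintype_prod_eq_prod
      (fun l x => x ^ ((if l = i then 1 else 0) + (if l = j then 1 else 0)) *
        Real.exp (a l * x - a l ^ 2 / 2))]
    by_cases hij : i = j
    · subst hij
      rw [prod_eq_single i]
      · simp only [if_true, one_add_one_eq_two, integral_exp_tilt_two]
        ring
      · intro l _ hl
        simp [hl, integral_exp_tilt_zero]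
      · simp
    · rw [prod_eq_mul i j hij]
      · simp [hij, Ne.symm hij, integral_exp_tilt_one]
      · intro l _ hl
        simp [hl.1, hl.2, integral_exp_tilt_zero]
      · simp
      · simp

lemma integral_inner_mul_gaussianTilt (a v : ι → ℝ) :
    Integrable (fun g => (∑ i, g i * v i) * gaussianTilt a g) (gaussianPi ι) ∧
      ∫ g, (∑ i, g i * v i) * gaussianTilt a g ∂(gaussianPi ι) = ∑ i, a i * v i := by
  have h : ∀ g : ι → ℝ, (∑ i, g i * v i) * gaussianTilt a g =
      ∑ i, (g i * gaussianTilt a g) * v i := by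
    intro g; rw [sum_mul]; exact sum_congr rfl fun i _ => by ring
  simp only [h]
  constructor
  · exact integrable_finsetSum _ fun i _ => (integral_apply_mul_gaussianTilt a i).1.mul_const _
  · rw [integral_finsetSum _ fun i _ => (integral_apply_mul_gaussianTilt a i).1.mul_const _]
    simp only [integral_mul_const, (integral_apply_mul_gaussianTilt a _).2]

lemma integral_inner_sq_mul_gaussianTilt (a v : ι → ℝ) :
    Integrable (fun g => (∑ i, g i * v i) ^ 2 * gaussianTilt a g) (gaussianPi ι) ∧
      ∫ g, (∑ i, g i * v i) ^ 2 * gaussianTilt a g ∂(gaussianPi ι) =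
        (∑ i, a i * v i) ^ 2 + ∑ i, v i ^ 2 := by
  classical
  have h : ∀ g : ι → ℝ, (∑ i, g i * v i) ^ 2 * gaussianTilt a g =
      ∑ i, ∑ j, (g i * g j * gaussianTilt a g) * (v i * v j) := by
    intro g
    rw [pow_two, sum_mul_sum, sum_mul]
    refine sum_congr rfl fun i _ => ?_
    rw [sum_mul]
    exact sum_congr rfl fun j _ => by ring
  have hI := fun i j => (integral_apply_mul_apply_mul_gaussianTilt a i j).1.mul_const (v i * v j)
  simp only [h]
  constructor
  · exact integrable_finsetSum _ fun i _ => integrable_finsetSum _ fun j _ => hI i j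
  · rw [integral_finsetSum _ fun i _ => integrable_finsetSum _ fun j _ => hI i j]
    simp_rw [integral_finsetSum univ fun j _ => hI _ j, integral_mul_const,
      (integral_apply_mul_apply_mul_gaussianTilt a _ _).2, add_mul, sum_add_distrib]
    congr 1
    · rw [pow_two, sum_mul_sum]
      exact sum_congr rfl fun i _ => sum_congr rfl fun j _ => by ring
    · simp [pow_two]

/-- Jensen's inequality for the Gaussian average of the exponential of a quadratic form. -/
lemma exp_le_integral_gaussianPi {β : Type*} (s : Finset β) (M : ι → ℝ) (D : β → ι → ℝ)
    (h : ∑ b ∈ s, (∑ i, M i * D b i) ^ 2 ≤ ∑ i, M i ^ 2) :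
    Integrable (fun g => Real.exp (∑ i, g i * M i - (∑ b ∈ s, (∑ i, g i * D b i) ^ 2) / 2))
        (gaussianPi ι) ∧
    Real.exp ((∑ i, M i ^ 2) / 4 - (∑ b ∈ s, ∑ i, D b i ^ 2) / 2) ≤
      ∫ g, Real.exp (∑ i, g i * M i - (∑ b ∈ s, (∑ i, g i * D b i) ^ 2) / 2)
        ∂(gaussianPi ι) := by
  have hint : Integrable
      (fun g => Real.exp (∑ i, g i * M i - (∑ b ∈ s, (∑ i, g i * D b i) ^ 2) / 2))
      (gaussianPi ι) := by
    refine ((integral_gaussianTilt M).1.mul_const (Real.exp ((∑ i, M i ^ 2) / 2))).mono'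
      (Measurable.aestronglyMeasurable (by fun_prop)) (ae_of_all _ fun g => ?_)
    rw [Real.norm_eq_abs, Real.abs_exp, gaussianTilt_eq, ← Real.exp_add]
    refine Real.exp_le_exp.2 ?_
    have h0 : 0 ≤ ∑ b ∈ s, (∑ i, g i * D b i) ^ 2 := sum_nonneg fun b _ => sq_nonneg _
    simp only [mul_comm (g _) (M _)]
    linarith
  refine ⟨hint, ?_⟩
  -- After a shift by `λM` the mean exponent is at least `(λ - λ^2) T - V/2`, since the hypothesis
  -- bounds the quadratic form at `M` by `T`. The choice `λ = 1/2` maximizes this and gives `c`.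
  set a : ι → ℝ := fun i => M i / 2 with ha
  set T := ∑ i, M i ^ 2
  set V := ∑ b ∈ s, ∑ i, D b i ^ 2
  set c := T / 4 - V / 2 with hc
  have haM : ∑ i, a i * M i = T / 2 := by
    rw [sum_div]; exact sum_congr rfl fun i _ => by simp only [ha]; ring
  have ha2 : ∑ i, a i ^ 2 = T / 4 := by
    rw [sum_div]; exact sum_congr rfl fun i _ => by simp only [ha]; ring
  have haD : ∀ b, ∑ i, a i * D b i = (∑ i, M i * D b i) / 2 := fun b => by
    rw [sum_div]; exact sum_congr rfl fun i _ => by simp only [ha]; ring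
  set u : (ι → ℝ) → ℝ := fun g => ∑ i, g i * (M i - a i) -
    (∑ b ∈ s, (∑ i, g i * D b i) ^ 2) / 2 + T / 8 with hu
  have hpt : ∀ g, gaussianTilt a g * (Real.exp c * (1 - c + u g)) ≤
      Real.exp (∑ i, g i * M i - (∑ b ∈ s, (∑ i, g i * D b i) ^ 2) / 2) := by
    intro g
    have h1 : Real.exp (∑ i, g i * M i - (∑ b ∈ s, (∑ i, g i * D b i) ^ 2) / 2) =
        gaussianTilt a g * (Real.exp c * Real.exp (u g - c)) := by
      rw [gaussianTilt_eq, ← Real.exp_add, ← Real.exp_add, ha2]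
      congr 1
      simp only [hu, mul_sub, sum_sub_distrib, mul_comm (g _) (a _)]
      ring
    rw [h1]
    -- Jensen's inequality in tangent-line form: only first and second moments under the shifted
    -- Gaussian are needed.
    have h2 := Real.add_one_le_exp (u g - c)
    have h3 : 0 ≤ gaussianTilt a g := by rw [gaussianTilt_eq]; positivity
    refine mul_le_mul_of_nonneg_left (mul_le_mul_of_nonneg_left ?_ (Real.exp_pos c).le) h3
    linarith
  have hexp : ∀ g, gaussianTilt a g * (Real.exp c * (1 - c + u g)) =
      Real.exp c * ((1 - c + T / 8) * gaussianTilt a g +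
        (∑ i, g i * (M i - a i)) * gaussianTilt a g -
        (∑ b ∈ s, (∑ i, g i * D b i) ^ 2 * gaussianTilt a g) / 2) := by
    intro g
    rw [← sum_mul]
    simp only [hu]
    ring
  have hI1 := (integral_gaussianTilt a).1.const_mul (1 - c + T / 8)
  have hI2 := (integral_inner_mul_gaussianTilt a fun i => M i - a i).1
  have hI3 : Integrable (fun g => (∑ b ∈ s, (∑ i, g i * D b i) ^ 2 * gaussianTilt a g) / 2)
      (gaussianPi ι) :=
    (integrable_finsetSum s fun b _ =>
      (integral_inner_sq_mul_gaussianTilt a (D b)).1).div_const 2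
  have hI12 : Integrable (fun g => (1 - c + T / 8) * gaussianTilt a g +
      (∑ i, g i * (M i - a i)) * gaussianTilt a g) (gaussianPi ι) := hI1.add hI2
  have hval : ∫ g, gaussianTilt a g * (Real.exp c * (1 - c + u g)) ∂(gaussianPi ι) =
      Real.exp c * ((1 - c + T / 8) + (T / 2 - T / 4) -
        ((∑ b ∈ s, (∑ i, M i * D b i) ^ 2) / 4 + V) / 2) := by
    simp_rw [hexp]
    rw [integral_const_mul, integral_sub (hI12 : Integrable _ _) hI3, integral_add hI1 hI2,
      integral_const_mul, (integral_gaussianTilt a).2,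
      (integral_inner_mul_gaussianTilt a fun i => M i - a i).2, integral_div,
      integral_finsetSum s fun b _ => (integral_inner_sq_mul_gaussianTilt a (D b)).1]
    simp only [(integral_inner_sq_mul_gaussianTilt a (D _)).2, sum_add_distrib, mul_sub,
      sum_sub_distrib, haM, haD, ← pow_two, ha2, div_pow, ← sum_div]
    norm_num
    rfl
  refine le_trans ?_ (integral_mono ?_ hint hpt)
  · rw [hval]
    exact le_mul_of_one_le_right (Real.exp_pos c).le (by linarith)
  · simp_rw [hexp]
    exact (hI12.sub hI3).const_mul _

end Gaussian

/-! ### Martingale differences with respect to a family of flips -/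

section Flip

variable {Ω : Type*}

/-- `φ` changes sign under the `i`-th flip and is invariant under all later ones. -/
structure IsFlipDiff (τ : ℕ → Equiv.Perm Ω) (i : ℕ) (φ : Ω → ℝ) : Prop where
  flip : ∀ ω, φ (τ i ω) = -φ ω
  inv : ∀ j, i < j → ∀ ω, φ (τ j ω) = φ ω

namespace IsFlipDiff

variable {τ : ℕ → Equiv.Perm Ω} {i : ℕ} {φ ψ : Ω → ℝ}

lemma sum {β : Type*} {s : Finset β} {φ : β → Ω → ℝ} (h : ∀ b ∈ s, IsFlipDiff τ i (φ b)) :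
    IsFlipDiff τ i fun ω => ∑ b ∈ s, φ b ω :=
  ⟨fun ω => by rw [← sum_neg_distrib]; exact sum_congr rfl fun b hb => (h b hb).flip ω,
    fun j hj ω => sum_congr rfl fun b hb => (h b hb).inv j hj ω⟩

lemma mul_inv (h : IsFlipDiff τ i φ) (hψ : ∀ j, i ≤ j → ∀ ω, ψ (τ j ω) = ψ ω) :
    IsFlipDiff τ i fun ω => φ ω * ψ ω :=
  ⟨fun ω => by rw [h.flip, hψ i le_rfl, neg_mul],
    fun j hj ω => by rw [h.inv j hj, hψ j hj.le]⟩

lemma mul_const (h : IsFlipDiff τ i φ) (c : ℝ) : IsFlipDiff τ i fun ω => φ ω * c :=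
  h.mul_inv fun _ _ _ => rfl

lemma const_mul (h : IsFlipDiff τ i φ) (c : ℝ) : IsFlipDiff τ i fun ω => c * φ ω := by
  simpa only [mul_comm c] using h.mul_const c

end IsFlipDiff

variable [Fintype Ω]

lemma expect_comp_perm (e : Equiv.Perm Ω) (φ : Ω → ℝ) : 𝔼 ω, φ (e ω) = 𝔼 ω, φ ω :=
  Fintype.expect_equiv e _ _ fun _ => rfl

/-- Averaging over a flip plays the role of a conditional expectation; no filtration is needed. -/
lemma expect_eq_half_add (e : Equiv.Perm Ω) (φ : Ω → ℝ) :
    𝔼 ω, φ ω = 𝔼 ω, (φ ω + φ (e ω)) / 2 := by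
  rw [← expect_div, expect_add_distrib, expect_comp_perm]
  ring

/-- The exponential supermartingale inequality for conditionally symmetric differences. -/
lemma expect_exp_sub_le_one [Nonempty Ω] {τ : ℕ → Equiv.Perm Ω} {D : ℕ → Ω → ℝ}
    (h : ∀ i, IsFlipDiff τ i (D i)) (N : ℕ) :
    𝔼 ω, Real.exp (∑ i ∈ range N, D i ω - (∑ i ∈ range N, D i ω ^ 2) / 2) ≤ 1 := by
  induction N with
  | zero => simp
  | succ N ih =>
    refine le_trans ?_ ih
    -- The last flip fixes all earlier differences and negates `D N`, so `cosh x ≤ exp (x^2/2)`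
    -- removes the last term.
    rw [expect_eq_half_add (τ N)]
    refine expect_le_expect fun ω _ => ?_
    have h1 : ∑ i ∈ range N, D i (τ N ω) = ∑ i ∈ range N, D i ω :=
      sum_congr rfl fun i hi => (h i).inv N (mem_range.1 hi) ω
    have h2 : ∑ i ∈ range N, D i (τ N ω) ^ 2 = ∑ i ∈ range N, D i ω ^ 2 :=
      sum_congr rfl fun i hi => by rw [(h i).inv N (mem_range.1 hi) ω]
    simp only [sum_range_succ, h1, h2, (h N).flip, neg_sq]
    set A := ∑ i ∈ range N, D i ω
    set B := ∑ i ∈ range N, D i ω ^ 2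
    set x := D N ω
    have h3 := Real.cosh_le_exp_half_sq x
    rw [Real.cosh_eq] at h3
    have e1 : Real.exp (A + x - (B + x ^ 2) / 2) =
        Real.exp (A - B / 2) * Real.exp (-(x ^ 2 / 2)) * Real.exp x := by
      rw [← Real.exp_add, ← Real.exp_add]; congr 1; ring
    have e2 : Real.exp (A + -x - (B + x ^ 2) / 2) =
        Real.exp (A - B / 2) * Real.exp (-(x ^ 2 / 2)) * Real.exp (-x) := by
      rw [← Real.exp_add, ← Real.exp_add]; congr 1; ring
    have e3 : Real.exp (-(x ^ 2 / 2)) * Real.exp (x ^ 2 / 2) = 1 := by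
      rw [← Real.exp_add]; simp
    rw [e1, e2]
    calc _ = Real.exp (A - B / 2) * (Real.exp (-(x ^ 2 / 2)) *
          ((Real.exp x + Real.exp (-x)) / 2)) := by ring
      _ ≤ Real.exp (A - B / 2) * (Real.exp (-(x ^ 2 / 2)) * Real.exp (x ^ 2 / 2)) := by gcongr
      _ = _ := by rw [e3, mul_one]

/-! ### Moments of the norm of a Hilbert space valued martingale -/

/-- Moments from exponential integrability on the sets where a second function is small. -/
lemma MomentLE.of_exp [Nonempty Ω] {W κ : Ω → ℝ} {p : ℕ} {B : ℝ} (hp : p ≠ 0) (hB : 0 < B)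
    (hW : ∀ ω, 0 ≤ W ω) (hκ : MomentLE κ (4 * p) B)
    (h : ∀ l : ℝ, 0 < l → 𝔼 ω, (if l * κ ω ≤ 1 then Real.exp (l * W ω / 4) else 0) ≤ 2) :
    MomentLE W p (256 * p * B) := by
  refine ⟨hW, by positivity, ?_⟩
  -- Dyadic scale of `κ/B`; the exponential hypothesis is used with `l = (2^j B)⁻¹` at each scale
  -- `j`.
  have hi : ∀ ω, ∃ i : ℕ, κ ω ≤ 2 ^ i * B ∧ (2 : ℝ) ^ i ≤ 2 + 2 / B * κ ω := by
    intro ω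
    have hx : (1 : ℝ) ≤ 1 + κ ω / B := by
      have := div_nonneg (hκ.nonneg ω) hB.le
      linarith
    obtain ⟨n, h1, h2⟩ := exists_nat_pow_near hx one_lt_two
    refine ⟨n + 1, ?_, ?_⟩
    · rw [← div_le_iff₀ hB]; linarith
    · rw [pow_succ]
      have : 2 / B * κ ω = 2 * (κ ω / B) := by ring
      linarith
  choose i hi1 hi2 using hi
  set I := univ.sup i + 1
  have hiI : ∀ ω, i ω ∈ range I := fun ω =>
    mem_range.2 (Nat.lt_succ_of_le (le_sup (f := i) (mem_univ ω)))
  -- A weight that outgrows the factor `2^(2pj)` of the moment at scale `j` by `2^j`, so that the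
  -- scales sum geometrically. Its own mean is controlled by the `4p`-th moment of `κ`, because `2p
  -- + 1 ≤ 4p`.
  set q : Ω → ℝ := fun ω => (2 ^ (2 * p + 1)) ^ i ω with hq
  have hq0 : ∀ ω, 0 < q ω := fun ω => by positivity
  have step : ∀ j : ℕ, 𝔼 ω, (if κ ω ≤ 2 ^ j * B then W ω ^ (2 * p) else 0) ≤
      2 * (8 * p * (2 ^ j * B)) ^ (2 * p) := by
    intro j
    have hc : (0 : ℝ) < 2 ^ j * B := by positivity
    have h1 := h (2 ^ j * B)⁻¹ (by positivity)
    have h2 : ∀ ω, (if κ ω ≤ 2 ^ j * B then W ω ^ (2 * p) else 0) ≤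
        (8 * p * (2 ^ j * B)) ^ (2 * p) *
          (if (2 ^ j * B)⁻¹ * κ ω ≤ 1 then Real.exp ((2 ^ j * B)⁻¹ * W ω / 4) else 0) := by
      intro ω
      have h3 : (2 ^ j * B)⁻¹ * κ ω ≤ 1 ↔ κ ω ≤ 2 ^ j * B := by
        rw [inv_mul_le_iff₀ hc, mul_one]
      simp only [h3]
      split_ifs
      · have h4 := Real.pow_div_factorial_le_exp ((2 ^ j * B)⁻¹ * W ω / 4)
          (by have := hW ω; positivity) (2 * p)
        have h5 : ((2 * p).factorial : ℝ) ≤ (2 * p : ℝ) ^ (2 * p) := by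
          exact_mod_cast Nat.factorial_le_pow (2 * p)
        rw [div_le_iff₀ (by positivity)] at h4
        calc W ω ^ (2 * p) = (4 * (2 ^ j * B)) ^ (2 * p) *
              ((2 ^ j * B)⁻¹ * W ω / 4) ^ (2 * p) := by
              rw [← mul_pow]; congr 1; field_simp
          _ ≤ (4 * (2 ^ j * B)) ^ (2 * p) * (Real.exp ((2 ^ j * B)⁻¹ * W ω / 4) *
              (2 * p : ℝ) ^ (2 * p)) := by gcongr; exact h4.trans (by gcongr)
          _ = (4 * (2 ^ j * B) * (2 * p)) ^ (2 * p) * Real.exp ((2 ^ j * B)⁻¹ * W ω / 4) := by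
              rw [mul_pow _ (2 * p : ℝ)]; ring
          _ = _ := by congr 2; ring
      · simp
    refine (expect_le_expect fun ω _ => h2 ω).trans ?_
    rw [← mul_expect, mul_comm (2 : ℝ)]
    exact mul_le_mul_of_nonneg_left h1 (by positivity)
  have h1 : 𝔼 ω, W ω ^ (2 * p) / q ω ≤ 4 * (8 * p * B) ^ (2 * p) := by
    have hpt : ∀ ω, W ω ^ (2 * p) / q ω ≤ ∑ j ∈ range I, ((2 ^ (2 * p + 1)) ^ j)⁻¹ *
        (if κ ω ≤ 2 ^ j * B then W ω ^ (2 * p) else 0) := by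
      intro ω
      refine le_trans (le_of_eq ?_) (single_le_sum (f := fun j => ((2 ^ (2 * p + 1)) ^ j)⁻¹ *
        (if κ ω ≤ 2 ^ j * B then W ω ^ (2 * p) else 0)) (fun j _ => ?_) (hiI ω))
      · simp only [hi1 ω, if_true, hq]
        rw [div_eq_inv_mul]
      · have := hW ω
        split_ifs <;> positivity
    refine (expect_le_expect fun ω _ => hpt ω).trans ?_
    rw [expect_sum_comm]
    simp only [← mul_expect]
    calc _ ≤ ∑ j ∈ range I, (((2 : ℝ) ^ (2 * p + 1)) ^ j)⁻¹ *
          (2 * (8 * p * (2 ^ j * B)) ^ (2 * p)) :=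
          sum_le_sum fun j _ => mul_le_mul_of_nonneg_left (step j) (by positivity)
      _ = (2 * (8 * p * B) ^ (2 * p)) * ∑ j ∈ range I, (1 / 2 : ℝ) ^ j := by
          rw [mul_sum]
          refine sum_congr rfl fun j _ => ?_
          have : (8 * p * (2 ^ j * B)) ^ (2 * p) = (8 * p * B) ^ (2 * p) * (2 ^ j) ^ (2 * p) := by
            rw [← mul_pow]; congr 1; ring
          rw [this, ← pow_mul, ← pow_mul, one_div, inv_pow, mul_comm (2 * p + 1) j, mul_add, pow_add,
            mul_one]
          field_simp
      _ ≤ (2 * (8 * p * B) ^ (2 * p)) * 2 := by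
          refine mul_le_mul_of_nonneg_left ?_ (by positivity)
          have h2 := summable_geometric_two.sum_le_tsum (range I) fun j _ => by positivity
          rwa [tsum_geometric_two] at h2
      _ = _ := by ring
  have h2 : 𝔼 ω, q ω ≤ 4 ^ (4 * p) := by
    have h3 : MomentLE (fun ω => 2 + 2 / B * κ ω) (4 * p) (2 + 2 / B * B) :=
      (MomentLE.of_le (φ := fun _ : Ω => (2 : ℝ)) (fun _ => by norm_num) (fun _ => le_rfl) _).add
        (hκ.const_mul (by positivity)) (by omega)
    have h4 : (2 : ℝ) + 2 / B * B = 4 := by field_simp; norm_num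
    rw [h4] at h3
    refine le_trans (expect_le_expect fun ω _ => ?_) h3.expect_le
    simp only [hq]
    rw [← pow_mul, mul_comm, pow_mul]
    have h5 : (1 : ℝ) ≤ 2 ^ i ω := one_le_pow₀ (by norm_num)
    exact (pow_le_pow_right₀ h5 (by omega)).trans (pow_le_pow_left₀ (by positivity) (hi2 ω) _)
  -- Cauchy-Schwarz separates the weighted `2p`-th moment of `W` from the mean of the weight.
  have h3 := expect_mul_sq_le_sq_mul_sq univ (fun ω => W ω ^ p / √(q ω)) fun ω => √(q ω)
  have h4 : ∀ ω, W ω ^ p / √(q ω) * √(q ω) = W ω ^ p := fun ω =>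
    div_mul_cancel₀ _ (Real.sqrt_pos.2 (hq0 ω)).ne'
  simp only [h4, div_pow, Real.sq_sqrt (hq0 _).le, ← pow_mul, mul_comm p 2] at h3
  have h5 : (𝔼 ω, W ω ^ p) ^ 2 ≤ (2 * (128 * p * B) ^ p) ^ 2 := by
    refine h3.trans ((mul_le_mul h1 h2 (expect_nonneg fun ω _ => (hq0 ω).le)
      (by positivity)).trans (le_of_eq ?_))
    rw [show (128 * p * B : ℝ) = 8 * p * B * 16 by ring, mul_pow _ (16 : ℝ),
      show (4 : ℝ) ^ (4 * p) = (16 ^ p) ^ 2 by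
        rw [← pow_mul, show (16 : ℝ) = 4 ^ 2 by norm_num, ← pow_mul]
        congr 1
        ring,
      mul_comm 2 p, pow_mul]
    ring
  have h6 : 𝔼 ω, W ω ^ p ≤ 2 * (128 * p * B) ^ p :=
    le_of_pow_le_pow_left₀ two_ne_zero (by positivity) h5
  refine h6.trans ?_
  rw [show (256 * p * B : ℝ) = 2 * (128 * p * B) by ring, mul_pow (2 : ℝ)]
  exact mul_le_mul_of_nonneg_right (le_self_pow₀ (by norm_num) hp) (by positivity)

/-- A bound for the norm of a martingale in a Hilbert space by its square function and the
Hilbert-Schmidt norm of its bracket. -/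
lemma MomentLE.sum_sq_of_flipDiff [Nonempty Ω] {ι : Type*} [Fintype ι] {τ : ℕ → Equiv.Perm Ω}
    {D : ℕ → ι → Ω → ℝ} (h : ∀ b J, IsFlipDiff τ b (D b J)) {N p : ℕ} {A B : ℝ} (hp : p ≠ 0)
    (hB : 0 < B) (hV : MomentLE (fun ω => ∑ b ∈ range N, ∑ J, D b J ω ^ 2) p A)
    (hκ : MomentLE (fun ω => √(∑ J, ∑ J', (∑ b ∈ range N, D b J ω * D b J' ω) ^ 2)) (4 * p) B) :
    MomentLE (fun ω => ∑ J, (∑ b ∈ range N, D b J ω) ^ 2) p (2 * A + 256 * p * B) := by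
  set U : Ω → ℝ := fun ω => ∑ J, (∑ b ∈ range N, D b J ω) ^ 2 with hU
  set V : Ω → ℝ := fun ω => ∑ b ∈ range N, ∑ J, D b J ω ^ 2 with hVdef
  set κ : Ω → ℝ := fun ω => √(∑ J, ∑ J', (∑ b ∈ range N, D b J ω * D b J' ω) ^ 2) with hκdef
  have hU0 : ∀ ω, 0 ≤ U ω := fun ω => sum_nonneg fun J _ => sq_nonneg _
  -- The operator norm of the bracket is at most its Hilbert-Schmidt norm `κ`. With `l κ ≤ 1` this
  -- is the smallness condition of `exp_le_integral_gaussianPi`.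
  have hop : ∀ ω (M : ι → ℝ), ∑ b ∈ range N, (∑ J, M J * D b J ω) ^ 2 ≤ κ ω * ∑ J, M J ^ 2 := by
    intro ω M
    have h1 : ∑ b ∈ range N, (∑ J, M J * D b J ω) ^ 2 =
        ∑ x : ι × ι, (∑ b ∈ range N, D b x.1 ω * D b x.2 ω) * (M x.1 * M x.2) := by
      rw [Fintype.sum_prod_type]
      simp_rw [pow_two, sum_mul_sum, sum_mul]
      rw [sum_comm]
      refine sum_congr rfl fun J _ => ?_
      rw [sum_comm]
      exact sum_congr rfl fun J' _ => sum_congr rfl fun b _ => by ring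
    have h2 : ∑ x : ι × ι, (M x.1 * M x.2) ^ 2 = (∑ J, M J ^ 2) ^ 2 := by
      rw [Fintype.sum_prod_type, pow_two, sum_mul_sum]
      simp only [mul_pow]
    rw [h1]
    refine (le_abs_self _).trans (abs_le_of_sq_le_sq ?_ ?_)
    · refine (sum_mul_sq_le_sq_mul_sq _ _ _).trans (le_of_eq ?_)
      rw [h2, mul_pow, hκdef, Real.sq_sqrt (by positivity), Fintype.sum_prod_type]
    · positivity
  have key : ∀ l : ℝ, 0 < l →
      𝔼 ω, (if l * κ ω ≤ 1 then Real.exp (l * U ω / 4 - l * V ω / 2) else 0) ≤ 1 := by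
    intro l hl
    set E : Ω → (ι → ℝ) → ℝ := fun ω g =>
      Real.exp (∑ J, g J * (√l * ∑ b ∈ range N, D b J ω) -
        (∑ b ∈ range N, (∑ J, g J * (√l * D b J ω)) ^ 2) / 2) with hE
    have hint : ∀ ω, Integrable (E ω) (gaussianPi ι) := by
      intro ω
      refine ((integral_gaussianTilt fun J => √l * ∑ b ∈ range N, D b J ω).1.mul_const
        (Real.exp ((∑ J, (√l * ∑ b ∈ range N, D b J ω) ^ 2) / 2))).mono'
        (Measurable.aestronglyMeasurable (by fun_prop)) (ae_of_all _ fun g => ?_)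
      rw [Real.norm_eq_abs, Real.abs_exp, gaussianTilt_eq, ← Real.exp_add]
      refine Real.exp_le_exp.2 ?_
      have h0 : 0 ≤ ∑ b ∈ range N, (∑ J, g J * (√l * D b J ω)) ^ 2 :=
        sum_nonneg fun b _ => sq_nonneg _
      simp only [mul_comm (g _)] at h0 ⊢
      linarith
    have hle : ∀ ω, (if l * κ ω ≤ 1 then Real.exp (l * U ω / 4 - l * V ω / 2) else 0) ≤
        ∫ g, E ω g ∂(gaussianPi ι) := by
      intro ω
      split_ifs with hω
      · have h1 := exp_le_integral_gaussianPi (range N) (fun J => √l * ∑ b ∈ range N, D b J ω)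
          (fun b J => √l * D b J ω) (by
            have h2 := hop ω fun J => ∑ b ∈ range N, D b J ω
            have h3 : ∀ b, ∑ J, √l * (∑ b ∈ range N, D b J ω) * (√l * D b J ω) =
                l * ∑ J, (∑ b ∈ range N, D b J ω) * D b J ω := by
              intro b
              rw [mul_sum]
              refine sum_congr rfl fun J _ => ?_
              calc _ = (√l * √l) * ((∑ b ∈ range N, D b J ω) * D b J ω) := by ring
                _ = _ := by rw [Real.mul_self_sqrt hl.le]
            simp only [h3, mul_pow, Real.sq_sqrt hl.le, ← mul_sum]
            have h4 : 0 ≤ U ω := hU0 ω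
            calc _ ≤ l ^ 2 * (κ ω * U ω) := mul_le_mul_of_nonneg_left h2 (by positivity)
              _ = l * κ ω * (l * U ω) := by ring
              _ ≤ 1 * (l * U ω) := mul_le_mul_of_nonneg_right hω (by positivity)
              _ = _ := one_mul _)
        refine le_trans (le_of_eq ?_) h1.2
        simp only [mul_pow, Real.sq_sqrt hl.le, ← mul_sum]
        rfl
      · exact integral_nonneg fun g => (Real.exp_pos _).le
    refine (expect_le_expect fun ω _ => hle ω).trans ?_
    have hswap : 𝔼 ω, ∫ g, E ω g ∂(gaussianPi ι) = ∫ g, 𝔼 ω, E ω g ∂(gaussianPi ι) := by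
      simp only [Fintype.expect_eq_sum_div_card]
      rw [integral_div, integral_finsetSum _ fun ω _ => hint ω]
    have hle1 : ∀ g, 𝔼 ω, E ω g ≤ 1 := by
      intro g
      -- For frozen `g` the pairing with `g` is a scalar flip martingale.
      have h1 := expect_exp_sub_le_one (τ := τ)
        (D := fun b ω => ∑ J, g J * (√l * D b J ω))
        (fun b => IsFlipDiff.sum fun J _ => ((h b J).const_mul _).const_mul _) N
      refine le_trans (le_of_eq (expect_congr rfl fun ω _ => ?_)) h1
      simp only [hE]
      congr 2
      simp only [mul_sum]
      rw [sum_comm]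
    rw [hswap]
    calc _ ≤ ∫ _g, (1 : ℝ) ∂(gaussianPi ι) := by
          refine integral_mono ?_ (integrable_const _) hle1
          simp only [Fintype.expect_eq_sum_div_card]
          exact (integrable_finsetSum _ fun ω _ => hint ω).div_const _
      _ = 1 := by simp
  -- Truncating at 0 adds at most 1 to the exponential moment, whence the bound 2 required by
  -- `MomentLE.of_exp`.
  have hW : MomentLE (fun ω => max (U ω - 2 * V ω) 0) p (256 * p * B) := by
    refine MomentLE.of_exp hp hB (fun ω => le_max_right _ _) hκ fun l hl => ?_
    have h1 : ∀ ω, (if l * κ ω ≤ 1 then Real.exp (l * max (U ω - 2 * V ω) 0 / 4) else 0) ≤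
        (if l * κ ω ≤ 1 then Real.exp (l * U ω / 4 - l * V ω / 2) else 0) + 1 := by
      intro ω
      split_ifs
      · rcases max_cases (U ω - 2 * V ω) 0 with ⟨h1, -⟩ | ⟨h1, -⟩ <;> rw [h1]
        · rw [show l * (U ω - 2 * V ω) / 4 = l * U ω / 4 - l * V ω / 2 by ring]
          linarith
        · simp [(Real.exp_pos _).le]
      · norm_num
    refine (expect_le_expect fun ω _ => h1 ω).trans ?_
    rw [expect_add_distrib, Fintype.expect_const]
    linarith [key l hl]
  refine ((hV.const_mul zero_le_two).add hW hp).mono hU0 (fun ω => ?_) le_rfl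
  have := le_max_left (U ω - 2 * V ω) 0
  linarith

end Flip

/-! ### Two-point inequalities -/

section TwoPoint

/-- The even and odd parts `E`, `O` of `(a ± b)^(2k)` in `b` satisfy a coupled recursion. The
estimate `a O ≤ 2 k b E` bounds the growth of `E` per step by `a^2 + 4(k+1)b^2`. -/
lemma half_add_pow_le {a b : ℝ} (ha : 0 ≤ a) (hb : 0 ≤ b) (k : ℕ) :
    ((a + b) ^ (2 * k) + (a - b) ^ (2 * k)) / 2 ≤ (a ^ 2 + 4 * k * b ^ 2) ^ k := by
  set E : ℕ → ℝ := fun k => ((a + b) ^ (2 * k) + (a - b) ^ (2 * k)) / 2 with hE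
  set O : ℕ → ℝ := fun k => ((a + b) ^ (2 * k) - (a - b) ^ (2 * k)) / 2 with hO
  have hEs : ∀ k, E (k + 1) = (a ^ 2 + b ^ 2) * E k + 2 * a * b * O k := fun k => by
    simp only [hE, hO, mul_add, pow_add]; ring
  have hOs : ∀ k, O (k + 1) = (a ^ 2 + b ^ 2) * O k + 2 * a * b * E k := fun k => by
    simp only [hE, hO, mul_add, pow_add]; ring
  have hE0 : ∀ k, 0 ≤ E k := fun k => by
    have h1 := (even_two_mul k).pow_nonneg (a + b)
    have h2 := (even_two_mul k).pow_nonneg (a - b)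
    simp only [hE]; linarith
  have hO0 : ∀ k, 0 ≤ O k := by
    intro k
    induction k with
    | zero => simp [hO]
    | succ k ih => rw [hOs]; have := hE0 k; positivity
  have hOE : ∀ k : ℕ, a * O k ≤ 2 * k * b * E k := by
    intro k
    induction k with
    | zero => simp [hO]
    | succ k ih =>
      rw [hOs, hEs]
      have h1 := mul_le_mul_of_nonneg_left ih (show 0 ≤ a ^ 2 + b ^ 2 by positivity)
      have h2 : 0 ≤ b * E k * b ^ 2 := by have := hE0 k; positivity
      have h3 : 0 ≤ (k + 1) * b * (a * b * O k) := by have := hO0 k; positivity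
      push_cast
      nlinarith
  have hstep : ∀ k : ℕ, E (k + 1) ≤ (a ^ 2 + 4 * (k + 1) * b ^ 2) * E k := by
    intro k
    rw [hEs]
    have h1 := mul_le_mul_of_nonneg_left (hOE k) (show 0 ≤ 2 * b by positivity)
    have h2 : 0 ≤ b ^ 2 * E k := by have := hE0 k; positivity
    nlinarith
  have : ∀ j : ℕ, j ≤ k → E j ≤ (a ^ 2 + 4 * k * b ^ 2) ^ j := by
    intro j
    induction j with
    | zero => intro; simp [hE]
    | succ j ih =>
      intro hj
      have hjk : ((j : ℝ) + 1) ≤ k := by exact_mod_cast hj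
      refine (hstep j).trans ?_
      rw [pow_succ' (a ^ 2 + 4 * k * b ^ 2) j]
      exact mul_le_mul (by gcongr) (ih (by omega)) (hE0 j) (by positivity)
  exact this k le_rfl

/-- Spreading two points symmetrically about their mean increases the average of a convex function:
`x ± Y` are mirrored convex combinations of `x ± y`. -/
lemma half_add_pow_mono {X Y x y : ℝ} (h1 : 0 ≤ X + Y) (h2 : 0 ≤ X - Y) (hX : X ≤ x)
    (hY : |Y| ≤ y) (hyx : y ≤ x) (k : ℕ) :
    ((X + Y) ^ k + (X - Y) ^ k) / 2 ≤ ((x + y) ^ k + (x - y) ^ k) / 2 := by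
  have hy0 : 0 ≤ y := (abs_nonneg Y).trans hY
  have h3 : (X + Y) ^ k ≤ (x + Y) ^ k := pow_le_pow_left₀ h1 (by linarith) k
  have h4 : (X - Y) ^ k ≤ (x - Y) ^ k := pow_le_pow_left₀ h2 (by linarith) k
  suffices h : (x + Y) ^ k + (x - Y) ^ k ≤ (x + y) ^ k + (x - y) ^ k by linarith
  rcases hy0.eq_or_lt with rfl | hy
  · have : Y = 0 := abs_nonpos_iff.1 hY
    simp [this]
  have hYy := abs_le.1 hY
  set s := (y + Y) / (2 * y)
  set t := (y - Y) / (2 * y)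
  have hs : 0 ≤ s := div_nonneg (by linarith) (by linarith)
  have ht : 0 ≤ t := div_nonneg (by linarith) (by linarith)
  have hst : s + t = 1 := by simp only [s, t]; field_simp; ring
  have hsy : (s - t) * y = Y := by simp only [s, t]; field_simp; ring
  have hp : x + y ∈ Set.Ici (0 : ℝ) := Set.mem_Ici.2 (by linarith)
  have hm : x - y ∈ Set.Ici (0 : ℝ) := Set.mem_Ici.2 (by linarith)
  have c1 := (convexOn_pow (𝕜 := ℝ) k).2 hp hm hs ht hst
  have c2 := (convexOn_pow (𝕜 := ℝ) k).2 hp hm ht hs (by linarith)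
  simp only [smul_eq_mul] at c1 c2
  have e1 : s * (x + y) + t * (x - y) = x + Y := by
    rw [← hsy]; linear_combination x * hst
  have e2 : t * (x + y) + s * (x - y) = x - Y := by
    rw [← hsy]; linear_combination x * hst
  rw [e1] at c1
  rw [e2] at c2
  have h5 : (s + t) * ((x + y) ^ k + (x - y) ^ k) = (x + y) ^ k + (x - y) ^ k := by
    rw [hst, one_mul]
  linarith

end TwoPoint

/-! ### The Hilbert-Schmidt norm of a Gram matrix -/

section Gram

variable {ι β : Type*} [Fintype ι]

/-- The Hilbert-Schmidt norm of the matrix `V Vᵀ`, i.e. the square of the Schatten `4`-norm of the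
matrix `V` with rows indexed by `ι` and columns indexed by `t`. -/
def gramNorm (t : Finset β) (V : ι → β → ℝ) : ℝ :=
  √(∑ J, ∑ J', (∑ b ∈ t, V J b * V J' b) ^ 2)

lemma gramNorm_nonneg (t : Finset β) (V : ι → β → ℝ) : 0 ≤ gramNorm t V := Real.sqrt_nonneg _

lemma gramNorm_sq (t : Finset β) (V : ι → β → ℝ) :
    gramNorm t V ^ 2 = ∑ J, ∑ J', (∑ b ∈ t, V J b * V J' b) ^ 2 :=
  Real.sq_sqrt (sum_nonneg fun _ _ => sum_nonneg fun _ _ => sq_nonneg _)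

/-- The trace identity `‖A Bᵀ‖² = tr (AᵀA BᵀB)`, which allows Cauchy-Schwarz to separate `A` from
`B`. -/
lemma sum_sq_cross_eq (t : Finset β) (A B : ι → β → ℝ) :
    ∑ J, ∑ J', (∑ b ∈ t, A J b * B J' b) ^ 2 =
      ∑ x ∈ t ×ˢ t, (∑ J, A J x.1 * A J x.2) * ∑ J, B J x.1 * B J x.2 := by
  simp_rw [sum_product, pow_two, sum_mul_sum]
  calc _ = ∑ J, ∑ b ∈ t, ∑ J', ∑ b' ∈ t, A J b * B J' b * (A J b' * B J' b') :=
        sum_congr rfl fun J _ => sum_comm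
    _ = ∑ b ∈ t, ∑ J, ∑ J', ∑ b' ∈ t, A J b * B J' b * (A J b' * B J' b') := sum_comm
    _ = ∑ b ∈ t, ∑ J, ∑ b' ∈ t, ∑ J', A J b * B J' b * (A J b' * B J' b') :=
        sum_congr rfl fun b _ => sum_congr rfl fun J _ => sum_comm
    _ = ∑ b ∈ t, ∑ b' ∈ t, ∑ J, ∑ J', A J b * B J' b * (A J b' * B J' b') :=
        sum_congr rfl fun b _ => sum_comm
    _ = _ := sum_congr rfl fun b _ => sum_congr rfl fun b' _ => sum_congr rfl fun J _ =>
        sum_congr rfl fun J' _ => by ring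

lemma sum_sq_cross_le (t : Finset β) (A B : ι → β → ℝ) :
    ∑ J, ∑ J', (∑ b ∈ t, A J b * B J' b) ^ 2 ≤ gramNorm t A * gramNorm t B := by
  have h : ∀ A : ι → β → ℝ, ∑ x ∈ t ×ˢ t, (∑ J, A J x.1 * A J x.2) ^ 2 = gramNorm t A ^ 2 := by
    intro A
    rw [gramNorm_sq, sum_sq_cross_eq]
    exact sum_congr rfl fun _ _ => pow_two _
  rw [sum_sq_cross_eq]
  refine (le_abs_self _).trans (abs_le_of_sq_le_sq ?_
    (mul_nonneg (gramNorm_nonneg t A) (gramNorm_nonneg t B)))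
  refine (sum_mul_sq_le_sq_mul_sq _ _ _).trans (le_of_eq ?_)
  rw [h, h, mul_pow]

/-- The two-point inequality for the Schatten `4`-norm. -/
lemma half_gramNorm_pow_le (t : Finset β) (A B : ι → β → ℝ) (k : ℕ) :
    (gramNorm t (fun J b => A J b + B J b) ^ (2 * k) +
      gramNorm t (fun J b => A J b - B J b) ^ (2 * k)) / 2 ≤
      (gramNorm t A + 8 * k * gramNorm t B) ^ (2 * k) := by
  set a := gramNorm t A with ha
  set b := gramNorm t B with hb
  have ha0 : 0 ≤ a := gramNorm_nonneg t A
  have hb0 : 0 ≤ b := gramNorm_nonneg t B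
  set p : ι × ι → ℝ := fun x => ∑ b ∈ t, A x.1 b * A x.2 b
  set q : ι × ι → ℝ := fun x => ∑ b ∈ t, B x.1 b * B x.2 b
  set u : ι × ι → ℝ := fun x => ∑ b ∈ t, A x.1 b * B x.2 b
  set v : ι × ι → ℝ := fun x => ∑ b ∈ t, B x.1 b * A x.2 b
  have hp : ∑ x, p x ^ 2 = a ^ 2 := by rw [ha, gramNorm_sq, Fintype.sum_prod_type]
  have hq : ∑ x, q x ^ 2 = b ^ 2 := by rw [hb, gramNorm_sq, Fintype.sum_prod_type]
  have hu : ∑ x, u x ^ 2 ≤ a * b := by rw [Fintype.sum_prod_type]; exact sum_sq_cross_le t A B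
  have hv : ∑ x, v x ^ 2 ≤ a * b := by
    rw [Fintype.sum_prod_type, mul_comm]; exact sum_sq_cross_le t B A
  set P := ∑ x, (p x + q x) ^ 2 with hP
  set Q := ∑ x, (u x + v x) ^ 2 with hQ
  -- The Gram matrix of `A ± B` is `(AAᵀ + BBᵀ) ± (ABᵀ + BAᵀ)`; its squared norm is `P + Q ± Y`.
  set Y := 2 * ∑ x, (p x + q x) * (u x + v x) with hY
  have hP0 : 0 ≤ P := sum_nonneg fun _ _ => sq_nonneg _
  have hQ0 : 0 ≤ Q := sum_nonneg fun _ _ => sq_nonneg _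
  have hPle : P ≤ (a + b) ^ 2 := by
    have h1 : ∑ x, p x * q x ≤ a * b := by
      refine (le_abs_self _).trans (abs_le_of_sq_le_sq ?_ (by positivity))
      refine (sum_mul_sq_le_sq_mul_sq _ _ _).trans (le_of_eq ?_)
      rw [hp, hq, mul_pow]
    have h2 : P = ∑ x, p x ^ 2 + 2 * ∑ x, p x * q x + ∑ x, q x ^ 2 := by
      rw [mul_sum, ← sum_add_distrib, ← sum_add_distrib]
      exact sum_congr rfl fun x _ => by ring
    rw [h2, hp, hq]
    linarith
  have hQle : Q ≤ 4 * (a * b) := by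
    have h1 : Q ≤ ∑ x, (2 * u x ^ 2 + 2 * v x ^ 2) :=
      sum_le_sum fun x _ => by nlinarith [sq_nonneg (u x - v x)]
    rw [sum_add_distrib, ← mul_sum, ← mul_sum] at h1
    linarith
  have hplus : gramNorm t (fun J b => A J b + B J b) ^ 2 = (P + Q) + Y := by
    rw [gramNorm_sq, hP, hQ, hY, mul_sum, ← sum_add_distrib, ← sum_add_distrib,
      Fintype.sum_prod_type]
    refine sum_congr rfl fun J _ => sum_congr rfl fun J' _ => ?_
    simp only [p, q, u, v, add_mul, mul_add, sum_add_distrib]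
    ring
  have hminus : gramNorm t (fun J b => A J b - B J b) ^ 2 = (P + Q) - Y := by
    rw [gramNorm_sq, hP, hQ, hY, mul_sum, ← sum_add_distrib, ← sum_sub_distrib,
      Fintype.sum_prod_type]
    refine sum_congr rfl fun J _ => sum_congr rfl fun J' _ => ?_
    simp only [p, q, u, v, sub_mul, mul_sub, sum_sub_distrib]
    ring
  set s := √a
  set r := √b
  have hs0 : 0 ≤ s := Real.sqrt_nonneg _
  have hr0 : 0 ≤ r := Real.sqrt_nonneg _
  have hs : s ^ 2 = a := Real.sq_sqrt ha0
  have hr : r ^ 2 = b := Real.sq_sqrt hb0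
  have hYle : |Y| ≤ 4 * (s * r) * (a + b) := by
    refine abs_le_of_sq_le_sq ?_ (by positivity)
    have h1 := sum_mul_sq_le_sq_mul_sq univ (fun x => p x + q x) fun x => u x + v x
    calc Y ^ 2 = 4 * (∑ x, (p x + q x) * (u x + v x)) ^ 2 := by rw [hY]; ring
      _ ≤ 4 * (P * Q) := by linarith
      _ ≤ 4 * ((a + b) ^ 2 * (4 * (a * b))) := by gcongr
      _ = (4 * (s * r) * (a + b)) ^ 2 := by rw [← hs, ← hr]; ring
  have h1 := half_add_pow_mono (X := P + Q) (Y := Y) (x := (a + b) ^ 2 + 4 * (a * b))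
    (y := 4 * (s * r) * (a + b)) (by rw [← hplus]; positivity) (by rw [← hminus]; positivity)
    (add_le_add hPle hQle) hYle (by
      rw [← sub_nonneg, ← hs, ← hr]
      have : (s ^ 2 + r ^ 2) ^ 2 + 4 * (s ^ 2 * r ^ 2) - 4 * (s * r) * (s ^ 2 + r ^ 2) =
          ((s - r) ^ 2) ^ 2 := by ring
      rw [this]; positivity) k
  rw [pow_mul, pow_mul, hplus, hminus]
  refine h1.trans ?_
  -- The bounds for `P`, `Q` and `Y` combine to exactly `(√a ± √b)^4`, so the scalar two-point
  -- inequality with exponent `2k` finishes.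
  have e1 : (a + b) ^ 2 + 4 * (a * b) + 4 * (s * r) * (a + b) = (s + r) ^ 4 := by
    rw [← hs, ← hr]; ring
  have e2 : (a + b) ^ 2 + 4 * (a * b) - 4 * (s * r) * (a + b) = (s - r) ^ 4 := by
    rw [← hs, ← hr]; ring
  rw [e1, e2, ← pow_mul, ← pow_mul, show 4 * k = 2 * (2 * k) by ring]
  refine (half_add_pow_le hs0 hr0 (2 * k)).trans (le_of_eq ?_)
  rw [hs, hr]
  push_cast
  ring

/-- Martingale type 2 of the Schatten 4-norm: since `gramNorm` is a squared norm, the triangle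
inequality alone would lose a factor of order `N` for equal bounds, while the two-point inequality,
applied flip by flip, loses `8k`. -/
lemma MomentLE.gramNorm_of_flipDiff {Ω : Type*} [Fintype Ω] {τ : ℕ → Equiv.Perm Ω} {t : Finset β}
    {V : ℕ → ι → β → Ω → ℝ} (h : ∀ c J b, IsFlipDiff τ c (V c J b)) {k : ℕ} (hk : k ≠ 0)
    {B : ℕ → ℝ} (N : ℕ)
    (hB : ∀ c < N, MomentLE (fun ω => gramNorm t fun J b => V c J b ω) (2 * k) (B c)) :
    MomentLE (fun ω => gramNorm t fun J b => ∑ c ∈ range N, V c J b ω) (2 * k)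
      (8 * k * ∑ c ∈ range N, B c) := by
  induction N with
  | zero =>
    refine ⟨fun _ => gramNorm_nonneg _ _, by simp, ?_⟩
    simp [gramNorm, hk]
  | succ N ih =>
    have ih' := ih fun c hc => hB c (hc.trans (Nat.lt_succ_self N))
    have h1 := ih'.add ((hB N (Nat.lt_succ_self N)).const_mul
      (show (0 : ℝ) ≤ 8 * k by positivity)) (by omega)
    refine ⟨fun _ => gramNorm_nonneg _ _, ?_, ?_⟩
    · rw [sum_range_succ, mul_add]
      exact h1.bound_nonneg
    rw [sum_range_succ, mul_add]
    refine le_trans ?_ h1.expect_le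
    rw [expect_eq_half_add (τ N)]
    refine expect_le_expect fun ω _ => ?_
    have h2 : ∀ J b, ∑ c ∈ range N, V c J b (τ N ω) = ∑ c ∈ range N, V c J b ω := fun J b =>
      sum_congr rfl fun c hc => (h c J b).inv N (mem_range.1 hc) ω
    simp only [sum_range_succ, h2, (h N _ _).flip, ← sub_eq_add_neg]
    exact half_gramNorm_pow_le t _ _ k

end Gram

/-! ### Sums over fibers -/

lemma sum_sq_fiber {R κ : Type*} [DecidableEq κ] (s : Finset R) (key : R → κ) {K : Finset κ}
    (h : ∀ r ∈ s, key r ∈ K) (g : R → ℝ) :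
    ∑ J ∈ K, (∑ r ∈ s with key r = J, g r) ^ 2 =
      ∑ r ∈ s, ∑ r' ∈ s, if key r = key r' then g r * g r' else 0 := by
  have h1 : ∀ J, (∑ r ∈ s with key r = J, g r) ^ 2 =
      ∑ r ∈ s with key r = J, ∑ r' ∈ s, if key r = key r' then g r * g r' else 0 := by
    intro J
    rw [pow_two, sum_mul_sum]
    refine sum_congr rfl fun r hr => ?_
    rw [sum_filter]
    refine sum_congr rfl fun r' _ => ?_
    rw [(mem_filter.1 hr).2]
    simp only [eq_comm]
  simp only [h1]
  exact sum_fiberwise_of_maps_to h _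

lemma abs_sum_le_one_of_subsingleton {R : Type*} {s : Finset R}
    (hs : ∀ x ∈ s, ∀ y ∈ s, x = y) {g : R → ℝ} (hg : ∀ x, |g x| ≤ 1) : |∑ x ∈ s, g x| ≤ 1 := by
  have h1 : (#s : ℝ) ≤ 1 := by exact_mod_cast card_le_one.2 hs
  calc |∑ x ∈ s, g x| ≤ ∑ x ∈ s, |g x| := abs_sum_le_sum_abs _ _
    _ ≤ ∑ _x ∈ s, (1 : ℝ) := sum_le_sum fun x _ => hg x
    _ ≤ 1 := by simpa using h1

/-! ### Truncated multi-indices -/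

section Trunc

variable {d : ℕ}

/-- The multi-index `r` with all coordinates from the `k`-th one on replaced by `0`. -/
def trunc (k : ℕ) (r : Fin d → ℕ) : Fin d → ℕ := fun i => if (i : ℕ) < k then r i else 0

lemma trunc_eq_iff {k : ℕ} {r s : Fin d → ℕ} :
    trunc k r = trunc k s ↔ ∀ i : Fin d, (i : ℕ) < k → r i = s i := by
  constructor
  · intro h i hi
    simpa [trunc, hi] using congrFun h i
  · intro h
    ext i
    simp only [trunc]
    split_ifs with hi
    · exact h i hi
    · rfl

lemma trunc_succ_eq_iff {k : Fin d} {r s : Fin d → ℕ} :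
    trunc (k + 1) r = trunc (k + 1) s ↔ trunc k r = trunc k s ∧ r k = s k := by
  simp only [trunc_eq_iff]
  constructor
  · exact fun h => ⟨fun i hi => h i (by omega), h k (by omega)⟩
  · rintro ⟨h1, h2⟩ i hi
    rcases Nat.lt_succ_iff_lt_or_eq.1 hi with h | h
    · exact h1 i h
    · rwa [Fin.ext h]

/-- A box containing all truncations of multi-indices with first coordinate in `I`. -/
def truncBox (I : Finset ℕ) (N k : ℕ) [NeZero d] : Finset (Fin d → ℕ) :=
  Fintype.piFinset fun i => if i = 0 then I else if (i : ℕ) < k then range N else {0}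

lemma card_truncBox_le [NeZero d] (I : Finset ℕ) {N : ℕ} (hN : 0 < N) (k : ℕ) :
    #(truncBox (d := d) I N (k + 1)) ≤ #I * N ^ k := by
  rw [truncBox, Fintype.card_piFinset, ← mul_prod_erase univ _ (mem_univ (0 : Fin d)), if_pos rfl]
  refine Nat.mul_le_mul_left _ ?_
  have h1 : ∀ i ∈ univ.erase (0 : Fin d),
      #(if i = 0 then I else if (i : ℕ) < k + 1 then range N else {0}) =
        if (i : ℕ) < k + 1 then N else 1 := by
    intro i hi
    rw [if_neg (ne_of_mem_erase hi)]
    split_ifs <;> simp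
  rw [prod_congr rfl h1, prod_ite, prod_const, prod_const_one, mul_one]
  refine Nat.pow_le_pow_right hN ?_
  have h2 : ((univ.erase (0 : Fin d)).filter fun i : Fin d => (i : ℕ) < k + 1).map Fin.valEmbedding ⊆
      Finset.Ioo 0 (k + 1) := by
    intro j hj
    simp only [mem_map, mem_filter, mem_erase, mem_univ, and_true, Fin.valEmbedding_apply] at hj
    obtain ⟨i, ⟨h3, h4⟩, rfl⟩ := hj
    exact mem_Ioo.2 ⟨Nat.pos_of_ne_zero fun h => h3 (Fin.ext (by simpa using h)), h4⟩
  simpa using card_le_card h2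

variable [NeZero d] {n : ℕ} {I : Finset ℕ}

lemma mem_block {r : Fin d → ℕ} : r ∈ block d n I ↔ ∑ i, r i = n ∧ r 0 ∈ I := by
  simp [block, hyperbolic, Nat.mem_antidiagonalTuple]

lemma lt_of_mem_block {r : Fin d → ℕ} (hr : r ∈ block d n I) (i : Fin d) : r i < n + 1 :=
  Nat.lt_succ_of_le ((mem_block.1 hr).1 ▸ single_le_sum (fun _ _ => Nat.zero_le _) (mem_univ i))

lemma image_trunc_subset (k : ℕ) :
    (block d n I).image (trunc (k + 1)) ⊆ truncBox I (n + 1) (k + 1) := by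
  intro J hJ
  obtain ⟨r, hr, rfl⟩ := mem_image.1 hJ
  refine Fintype.mem_piFinset.2 fun i => ?_
  simp only [trunc]
  split_ifs with h1 h2 h3
  · subst h1; exact (mem_block.1 hr).2
  · subst h1; simp at h2
  · exact mem_range.2 (lt_of_mem_block hr i)
  · simp

lemma card_image_trunc_le (k : ℕ) :
    #((block d n I).image (trunc (k + 1))) ≤ #I * (n + 1) ^ k :=
  (card_le_card (image_trunc_subset k)).trans (card_truncBox_le I n.succ_pos k)

/-- Truncated multi-indices are determined by their size and their coordinates except the first. -/
lemma card_image_trunc_filter_le (k : ℕ) (w : ℕ) :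
    #(((block d n I).image (trunc (k + 1))).filter fun J => ∑ i, J i = w) ≤ (n + 1) ^ k := by
  have h1 := card_truncBox_le (d := d) {0} n.succ_pos k
  rw [card_singleton, one_mul] at h1
  refine le_trans (card_le_card_of_injOn (fun J => Function.update J 0 0) ?_ ?_) h1
  · intro J hJ
    have h2 := Fintype.mem_piFinset.1 (image_trunc_subset k (mem_filter.1 hJ).1)
    refine Fintype.mem_piFinset.2 fun i => ?_
    by_cases hi : i = 0
    · subst hi; simp
    · have := h2 i
      simpa [hi] using this
  · intro J hJ J' hJ' hJJ
    have h2 := (mem_filter.1 hJ).2.trans (mem_filter.1 hJ').2.symm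
    have h3 : ∀ i, i ≠ 0 → J i = J' i := fun i hi => by
      simpa [hi] using congrFun hJJ i
    have e1 : J 0 + ∑ i ∈ univ.erase 0, J i = ∑ i, J i := add_sum_erase _ _ (mem_univ 0)
    have e2 : J' 0 + ∑ i ∈ univ.erase 0, J' i = ∑ i, J' i := add_sum_erase _ _ (mem_univ 0)
    have e3 : ∑ i ∈ univ.erase 0, J i = ∑ i ∈ univ.erase 0, J' i :=
      sum_congr rfl fun i hi => h3 i (ne_of_mem_erase hi)
    ext i
    by_cases hi : i = 0
    · subst hi; omega
    · exact h3 i hi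

lemma eq_of_mem_block {r s : Fin d → ℕ} (hr : r ∈ block d n I) (hs : s ∈ block d n I) (l : Fin d)
    (h : ∀ i, i ≠ l → r i = s i) : r = s := by
  have h2 := (mem_block.1 hr).1.trans (mem_block.1 hs).1.symm
  have e1 : r l + ∑ i ∈ univ.erase l, r i = ∑ i, r i := add_sum_erase _ _ (mem_univ l)
  have e2 : s l + ∑ i ∈ univ.erase l, s i = ∑ i, s i := add_sum_erase _ _ (mem_univ l)
  have e3 : ∑ i ∈ univ.erase l, r i = ∑ i ∈ univ.erase l, s i :=
    sum_congr rfl fun i hi => h i (ne_of_mem_erase hi)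
  ext i
  by_cases hi : i = l
  · subst hi; omega
  · exact h i hi

/-- Both totals equal `n`, so a smaller prefix sum must be compensated at `l`, the only later
coordinate where the indices may differ. -/
lemma lt_of_sum_trunc_lt {r s : Fin d → ℕ} (hr : r ∈ block d n I) (hs : s ∈ block d n I) {k : ℕ}
    (l : Fin d) (h : ∀ i : Fin d, k ≤ i → i ≠ l → r i = s i)
    (hlt : ∑ i, trunc k r i < ∑ i, trunc k s i) : s l < r l := by
  by_contra hcon
  have h1 : ∀ r : Fin d → ℕ, ∑ i, r i =
      ∑ i, trunc k r i + ∑ i : Fin d, if (i : ℕ) < k then 0 else r i := by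
    intro r
    rw [← sum_add_distrib]
    refine sum_congr rfl fun i _ => ?_
    simp only [trunc]
    split_ifs <;> simp
  have h2 : ∑ i : Fin d, (if (i : ℕ) < k then 0 else r i) ≤ ∑ i : Fin d, if (i : ℕ) < k then 0 else s i := by
    refine sum_le_sum fun i _ => ?_
    split_ifs with hi
    · exact le_rfl
    · by_cases hil : i = l
      · subst hil; omega
      · exact (h i (not_lt.1 hi) hil).le
  have h3 := (mem_block.1 hr).1
  have h4 := (mem_block.1 hs).1
  rw [h1] at h3 h4
  omega

end Trunc

/-! ### Sums of `r`-functions on a finite probability space -/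

/-- A family of functions indexed by multi-indices, bounded by `1`, such that `f r` is in each
coordinate `k` a martingale difference of level `r k`. -/
structure IsRFamily {Ω : Type*} {d : ℕ} (τ : Fin d → ℕ → Equiv.Perm Ω)
    (f : (Fin d → ℕ) → Ω → ℝ) : Prop where
  flipDiff : ∀ r k, IsFlipDiff (τ k) (r k) (f r)
  abs_le : ∀ r ω, |f r ω| ≤ 1

section RFamily

variable {Ω : Type*} {d : ℕ} {τ : Fin d → ℕ → Equiv.Perm Ω}
  {f : (Fin d → ℕ) → Ω → ℝ}

/-- The square function with respect to the first `k` coordinates. -/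
def squareFun (f : (Fin d → ℕ) → Ω → ℝ) (s : Finset (Fin d → ℕ)) (k : ℕ) (ω : Ω) : ℝ :=
  ∑ J ∈ s.image (trunc k), (∑ r ∈ s with trunc k r = J, f r ω) ^ 2

lemma squareFun_eq (s : Finset (Fin d → ℕ)) (k : ℕ) (ω : Ω) :
    squareFun f s k ω =
      ∑ r ∈ s, ∑ r' ∈ s, if trunc k r = trunc k r' then f r ω * f r' ω else 0 :=
  sum_sq_fiber s (trunc k) (fun _ hr => mem_image_of_mem _ hr) fun r => f r ω

lemma squareFun_nonneg (s : Finset (Fin d → ℕ)) (k : ℕ) (ω : Ω) : 0 ≤ squareFun f s k ω :=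
  sum_nonneg fun _ _ => sq_nonneg _

lemma squareFun_zero (s : Finset (Fin d → ℕ)) (ω : Ω) :
    squareFun f s 0 ω = (∑ r ∈ s, f r ω) ^ 2 := by
  rw [squareFun_eq, pow_two, sum_mul_sum]
  refine sum_congr rfl fun r _ => sum_congr rfl fun r' _ => ?_
  rw [if_pos (trunc_eq_iff.2 fun i hi => absurd hi (Nat.not_lt_zero _))]

/-- The sum of the `f r`, `r ∈ s`, with prescribed first `k` coordinates and `k`-th coordinate. -/
def cell (f : (Fin d → ℕ) → Ω → ℝ) (s : Finset (Fin d → ℕ)) (k : Fin d) (J : Fin d → ℕ) (b : ℕ)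
    (ω : Ω) : ℝ :=
  ∑ r ∈ s with trunc k r = J ∧ r k = b, f r ω

lemma isFlipDiff_cell (hf : IsRFamily τ f) (s : Finset (Fin d → ℕ)) (k : Fin d) (J : Fin d → ℕ)
    (b : ℕ) : IsFlipDiff (τ k) b (cell f s k J b) :=
  IsFlipDiff.sum fun r hr => by
    have := hf.flipDiff r k
    rwa [(mem_filter.1 hr).2.2] at this

lemma sum_cell (s : Finset (Fin d → ℕ)) (k : Fin d) (J : Fin d → ℕ) {N : ℕ}
    (hN : ∀ r ∈ s, r k < N) (ω : Ω) :
    ∑ b ∈ range N, cell f s k J b ω = ∑ r ∈ s with trunc k r = J, f r ω := by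
  simp only [cell, ← filter_filter]
  exact sum_fiberwise_of_maps_to (fun r hr => mem_range.2 (hN r (mem_filter.1 hr).1)) _

lemma squareFun_succ (s : Finset (Fin d → ℕ)) (k : Fin d) {N : ℕ} (hN : ∀ r ∈ s, r k < N) (ω : Ω) :
    squareFun f s (k + 1) ω =
      ∑ b ∈ range N, ∑ J : s.image (trunc (k : ℕ)), cell f s k J b ω ^ 2 := by
  have h1 := sum_sq_fiber s (fun r => (r k, trunc (k : ℕ) r))
    (K := range N ×ˢ s.image (trunc (k : ℕ)))
    (fun r hr => mem_product.2 ⟨mem_range.2 (hN r hr), mem_image_of_mem _ hr⟩) fun r => f r ω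
  rw [sum_product] at h1
  rw [squareFun_eq]
  simp only [trunc_succ_eq_iff, and_comm (a := trunc _ _ = trunc _ _)]
  simp only [Prod.mk.injEq] at h1
  rw [← h1]
  refine sum_congr rfl fun b _ => ?_
  rw [← sum_coe_sort (s.image (trunc (k : ℕ)))]
  simp only [cell, and_comm]

/-- The Hilbert-Schmidt norm of the bracket which controls the passage from the square function
in `k + 1` coordinates to the one in `k` coordinates. -/
def bracketNorm (f : (Fin d → ℕ) → Ω → ℝ) (K : Finset (Fin d → ℕ)) (N : ℕ)
    (s : Finset (Fin d → ℕ)) (k : Fin d) (ω : Ω) : ℝ :=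
  gramNorm (range N) fun (J : K) b => cell f s k J b ω

/-- The Hilbert-Schmidt norm of a positive semidefinite matrix is at most its trace. This crude
bound suffices for the scalar bracket at `k = 0`. -/
lemma gramNorm_le {ι β : Type*} [Fintype ι] (t : Finset β) (V : ι → β → ℝ) :
    gramNorm t V ≤ ∑ b ∈ t, ∑ J, V J b ^ 2 := by
  refine (abs_le_of_sq_le_sq' ?_ (sum_nonneg fun _ _ => sum_nonneg fun _ _ => sq_nonneg _)).2
  rw [gramNorm_sq, sum_comm (s := t), pow_two, sum_mul_sum]
  exact sum_le_sum fun J _ => sum_le_sum fun J' _ =>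
    sum_mul_sq_le_sq_mul_sq t (fun b => V J b) fun b => V J' b

lemma bracketNorm_le {s : Finset (Fin d → ℕ)} {k : Fin d} {N : ℕ} (hN : ∀ r ∈ s, r k < N) (ω : Ω) :
    bracketNorm f (s.image (trunc k)) N s k ω ≤ squareFun f s (k + 1) ω := by
  rw [squareFun_succ s k hN]
  exact gramNorm_le _ _

lemma MomentLE.squareFun_of_succ [Fintype Ω] [Nonempty Ω] (hf : IsRFamily τ f) {s : Finset (Fin d → ℕ)} {k : Fin d} {N : ℕ}
    (hN : ∀ r ∈ s, r k < N) {p : ℕ} {A B : ℝ} (hp : p ≠ 0) (hB : 0 < B)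
    (hA : MomentLE (squareFun f s (k + 1)) p A)
    (hκ : MomentLE (bracketNorm f (s.image (trunc k)) N s k) (4 * p) B) :
    MomentLE (squareFun f s k) p (2 * A + 256 * p * B) := by
  have h := MomentLE.sum_sq_of_flipDiff (N := N)
    (D := fun b (J : s.image (trunc (k : ℕ))) => cell f s k J b)
    (fun b J => isFlipDiff_cell hf s k J b) hp hB
    (hA.mono (fun ω => sum_nonneg fun _ _ => sum_nonneg fun _ _ => sq_nonneg _)
      (fun ω => (squareFun_succ s k hN ω).ge) le_rfl) hκ
  refine h.mono (squareFun_nonneg s k) (fun ω => le_of_eq ?_) le_rfl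
  simp only [sum_cell s k _ hN]
  exact (sum_coe_sort _ fun J => (∑ r ∈ s with trunc k r = J, f r ω) ^ 2).symm

variable [NeZero d] {n : ℕ} {I : Finset ℕ}

/-- The cells of a set of multi-indices on which the coordinates strictly between `k` and the
last one are constant contain at most one element. -/
lemma cell_subsingleton {s : Finset (Fin d → ℕ)} (hs : s ⊆ block d n I) {k l : Fin d}
    (hl : (l : ℕ) + 1 = d) (hconst : ∀ r ∈ s, ∀ r' ∈ s, ∀ i : Fin d, k < i → i < l → r i = r' i)
    {r r' : Fin d → ℕ} (hr : r ∈ s) (hr' : r' ∈ s) (hJ : trunc k r = trunc k r')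
    (hk : k < l) (h : r k = r' k ∨ r l = r' l) : r = r' := by
  have h1 := trunc_eq_iff.1 hJ
  have h2 := hconst r hr r' hr'
  rcases h with h | h
  · refine eq_of_mem_block (hs hr) (hs hr') l fun i hi => ?_
    rcases lt_trichotomy i k with h3 | rfl | h3
    · exact h1 i h3
    · exact h
    · exact h2 i h3 (lt_of_le_of_ne (Fin.le_def.2 (by omega)) hi)
  · refine eq_of_mem_block (hs hr) (hs hr') k fun i hi => ?_
    rcases lt_trichotomy i k with h3 | rfl | h3
    · exact h1 i h3
    · exact absurd rfl hi
    · by_cases hil : i = l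
      · rwa [hil]
      · exact h2 i h3 (lt_of_le_of_ne (Fin.le_def.2 (by omega)) hil)

/-- The trivial bound, used for prefixes of equal sum, where no cancellation is available. -/
lemma abs_cell_inner_le (hf : IsRFamily τ f) {s : Finset (Fin d → ℕ)} (hs : s ⊆ block d n I)
    {k l : Fin d} (hl : (l : ℕ) + 1 = d) (hk : k < l)
    (hconst : ∀ r ∈ s, ∀ r' ∈ s, ∀ i : Fin d, k < i → i < l → r i = r' i) (J J' : Fin d → ℕ)
    (ω : Ω) :
    (∑ b ∈ range (n + 1), cell f s k J b ω * cell f s k J' b ω) ^ 2 ≤ ((n : ℝ) + 1) ^ 2 := by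
  have h1 : ∀ J b, |cell f s k J b ω| ≤ 1 := fun J b =>
    abs_sum_le_one_of_subsingleton (fun x hx y hy => by
      obtain ⟨hx1, hx2, hx3⟩ := mem_filter.1 hx
      obtain ⟨hy1, hy2, hy3⟩ := mem_filter.1 hy
      exact cell_subsingleton hs hl hconst hx1 hy1 (hx2.trans hy2.symm) hk
        (Or.inl (hx3.trans hy3.symm))) fun r => hf.abs_le r ω
  rw [← sq_abs]
  refine pow_le_pow_left₀ (abs_nonneg _) ?_ 2
  calc |∑ b ∈ range (n + 1), cell f s k J b ω * cell f s k J' b ω| ≤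
        ∑ b ∈ range (n + 1), |cell f s k J b ω * cell f s k J' b ω| := abs_sum_le_sum_abs _ _
    _ ≤ ∑ _b ∈ range (n + 1), (1 : ℝ) := sum_le_sum fun b _ => by
        rw [abs_mul]; exact mul_le_one₀ (h1 J b) (abs_nonneg _) (h1 J' b)
    _ = n + 1 := by simp

variable [Fintype Ω] [Nonempty Ω]

/-! ### Moments of the bracket -/

/-- The `1 × 1` case of the Schatten inequality, a scalar Khintchine-type bound. -/
lemma MomentLE.sq_sum_of_flipDiff {τ : ℕ → Equiv.Perm Ω} {D : ℕ → Ω → ℝ}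
    (h : ∀ c, IsFlipDiff τ c (D c)) (hD : ∀ c ω, |D c ω| ≤ 1) {k : ℕ} (hk : k ≠ 0) (N : ℕ) :
    MomentLE (fun ω => (∑ c ∈ range N, D c ω) ^ 2) (2 * k) (8 * k * N) := by
  have hg : ∀ x : ℝ, gramNorm ({()} : Finset Unit) (fun _ : Unit => fun _ => x) = x ^ 2 := by
    intro x
    rw [gramNorm]
    simp only [sum_const, card_singleton, one_smul, univ_unique, ← pow_two]
    exact Real.sqrt_sq (sq_nonneg x)
  have h1 := MomentLE.gramNorm_of_flipDiff (ι := Unit) (t := ({()} : Finset Unit))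
    (V := fun c _ _ => D c) (fun c _ _ => h c) hk (B := fun _ => 1) N fun c _ =>
      MomentLE.of_le (fun ω => gramNorm_nonneg _ _) (fun ω => by
        rw [hg, ← sq_abs]
        exact pow_le_one₀ (abs_nonneg _) (hD c ω)) _
  simpa [hg] using h1

/-- A pair in the sum shares its coordinates from the `k`-th up to, but excluding, the last. The
smaller prefix sum forces a larger last coordinate on the first member, so the product is a flip
difference at that level. -/
lemma moment_cell_inner (hf : IsRFamily τ f) {s : Finset (Fin d → ℕ)} (hs : s ⊆ block d n I)
    {k l : Fin d} (hl : (l : ℕ) + 1 = d) (hk : k < l)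
    (hconst : ∀ r ∈ s, ∀ r' ∈ s, ∀ i : Fin d, k < i → i < l → r i = r' i) {p : ℕ} (hp : p ≠ 0)
    {J J' : Fin d → ℕ} (hJ : ∑ i, J i < ∑ i, J' i) :
    MomentLE (fun ω => (∑ b ∈ range (n + 1), cell f s k J b ω * cell f s k J' b ω) ^ 2) (2 * p)
      (8 * p * (n + 1)) := by
  set P : Finset ((Fin d → ℕ) × (Fin d → ℕ)) :=
    (s ×ˢ s).filter fun x => trunc k x.1 = J ∧ trunc k x.2 = J' ∧ x.1 k = x.2 k with hP
  have hPmem : ∀ x ∈ P, x.1 ∈ s ∧ x.2 ∈ s ∧ trunc k x.1 = J ∧ trunc k x.2 = J' ∧ x.1 k = x.2 k :=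
    fun x hx => by
      obtain ⟨h1, h2⟩ := mem_filter.1 hx
      exact ⟨(mem_product.1 h1).1, (mem_product.1 h1).2, h2⟩
  set D : ℕ → Ω → ℝ := fun v ω => ∑ x ∈ P with x.1 l = v, f x.1 ω * f x.2 ω with hD
  have hlt : ∀ x ∈ P, x.2 l < x.1 l := by
    intro x hx
    obtain ⟨h1, h2, h3, h4, h5⟩ := hPmem x hx
    refine lt_of_sum_trunc_lt (hs h1) (hs h2) (k := k) l (fun i hki hil => ?_)
      (by rw [h3, h4]; exact hJ)
    rcases (Fin.le_def.2 hki : k ≤ i).eq_or_lt with rfl | h6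
    · exact h5
    · exact hconst _ h1 _ h2 i h6 (lt_of_le_of_ne (Fin.le_def.2 (by omega)) hil)
  have hflip : ∀ v, IsFlipDiff (τ l) v (D v) := by
    intro v
    refine IsFlipDiff.sum fun x hx => ?_
    obtain ⟨hxP, rfl⟩ := mem_filter.1 hx
    exact (hf.flipDiff x.1 l).mul_inv fun j hj ω =>
      (hf.flipDiff x.2 l).inv j ((hlt x hxP).trans_le hj) ω
  -- The level `v` determines the first member of the pair, hence its `k`-th coordinate, hence the
  -- second member.
  have hbd : ∀ v ω, |D v ω| ≤ 1 := by
    intro v ω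
    refine abs_sum_le_one_of_subsingleton (fun x hx y hy => ?_) fun x => ?_
    · obtain ⟨hxP, hxv⟩ := mem_filter.1 hx
      obtain ⟨hyP, hyv⟩ := mem_filter.1 hy
      obtain ⟨h1, h2, h3, h4, h5⟩ := hPmem x hxP
      obtain ⟨g1, g2, g3, g4, g5⟩ := hPmem y hyP
      have e1 : x.1 = y.1 := cell_subsingleton hs hl hconst h1 g1 (h3.trans g3.symm) hk
        (Or.inr (hxv.trans hyv.symm))
      have e2 : x.2 = y.2 := cell_subsingleton hs hl hconst h2 g2 (h4.trans g4.symm) hk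
        (Or.inl (by rw [← h5, ← g5, e1]))
      exact Prod.ext e1 e2
    · rw [abs_mul]
      exact mul_le_one₀ (hf.abs_le _ ω) (abs_nonneg _) (hf.abs_le _ ω)
  have h1 := MomentLE.sq_sum_of_flipDiff hflip hbd hp (n + 1)
  push_cast at h1
  refine h1.mono (fun ω => sq_nonneg _) (fun ω => le_of_eq ?_) le_rfl
  congr 1
  have e1 : ∑ v ∈ range (n + 1), D v ω = ∑ x ∈ P, f x.1 ω * f x.2 ω :=
    sum_fiberwise_of_maps_to
      (fun x hx => mem_range.2 (lt_of_mem_block (hs (hPmem x hx).1) l)) _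
  have e2 : ∑ b ∈ range (n + 1), cell f s k J b ω * cell f s k J' b ω =
      ∑ b ∈ range (n + 1), ∑ x ∈ P with x.1 k = b, f x.1 ω * f x.2 ω := by
    refine sum_congr rfl fun b _ => ?_
    rw [cell, cell, sum_mul_sum, ← sum_product']
    refine sum_congr ?_ fun _ _ => rfl
    ext x
    simp only [hP, mem_product, mem_filter]
    constructor
    · rintro ⟨⟨h1, h2, h3⟩, h4, h5, h6⟩
      exact ⟨⟨⟨h1, h4⟩, h2, h5, h3.trans h6.symm⟩, h3⟩
    · rintro ⟨⟨⟨h1, h4⟩, h2, h5, h3⟩, h6⟩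
      exact ⟨⟨h1, h2, h6⟩, h4, h5, h3 ▸ h6⟩
  rw [e1, e2]
  exact sum_fiberwise_of_maps_to
    (fun x hx => mem_range.2 (lt_of_mem_block (hs (hPmem x hx).1) k)) _

end RFamily

section Bracket

variable {Ω : Type*} [Fintype Ω] [Nonempty Ω] {d : ℕ} {τ : Fin d → ℕ → Equiv.Perm Ω}
  {f : (Fin d → ℕ) → Ω → ℝ} [NeZero d] {n : ℕ} {I : Finset ℕ}

lemma moment_bracketNorm_of_const (hf : IsRFamily τ f) {s : Finset (Fin d → ℕ)}
    (hs : s ⊆ block d n I) {k l : Fin d} (hl : (l : ℕ) + 1 = d) (hk : k < l) {j : ℕ}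
    (hj : (k : ℕ) = j + 1)
    (hconst : ∀ r ∈ s, ∀ r' ∈ s, ∀ i : Fin d, k < i → i < l → r i = r' i) {p : ℕ} (hp : p ≠ 0)
    {m : ℝ} (hm : (#I : ℝ) ≤ m) :
    MomentLE (bracketNorm f ((block d n I).image (trunc k)) (n + 1) s k) (4 * p)
      (√(m * (n + 1) ^ (2 * j) * ((n + 1) ^ 2 + m * (8 * p * (n + 1))))) := by
  classical
  set K := (block d n I).image (trunc (k : ℕ)) with hK
  set e : K → K → ℝ := fun J J' =>
    if ∑ i, J.1 i = ∑ i, J'.1 i then ((n : ℝ) + 1) ^ 2 else 8 * p * (n + 1) with he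
  have hentry : ∀ J J' : K, MomentLE
      (fun ω => (∑ b ∈ range (n + 1), cell f s k J b ω * cell f s k J' b ω) ^ 2) (2 * p)
      (e J J') := by
    intro J J'
    rcases lt_trichotomy (∑ i, J.1 i) (∑ i, J'.1 i) with h | h | h
    · simp only [he, if_neg h.ne]
      exact moment_cell_inner hf hs hl hk hconst hp h
    · simp only [he, if_pos h]
      exact MomentLE.of_le (fun ω => sq_nonneg _)
        (fun ω => abs_cell_inner_le hf hs hl hk hconst _ _ ω) _
    · simp only [he, if_neg h.ne']
      simpa only [mul_comm] using moment_cell_inner hf hs hl hk hconst hp h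
  have hsum := MomentLE.sum (s := univ) (by omega : 2 * p ≠ 0) fun (J : K) _ =>
    MomentLE.sum (s := univ) (by omega : 2 * p ≠ 0) fun (J' : K) _ => hentry J J'
  have hcard : (#K : ℝ) ≤ m * (n + 1) ^ j := by
    have h1 : #K ≤ #I * (n + 1) ^ j := by rw [hK, hj]; exact card_image_trunc_le j
    calc (#K : ℝ) ≤ #I * (n + 1) ^ j := by exact_mod_cast h1
      _ ≤ _ := by gcongr
  have hm0 : 0 ≤ m := (Nat.cast_nonneg _).trans hm
  have hfib : ∀ w, #(K.filter fun J' => ∑ i, J' i = w) ≤ (n + 1) ^ j := by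
    rw [hK, hj]; exact card_image_trunc_filter_le j
  -- Prefixes with a prescribed sum lose one degree of freedom, the first coordinate, so the trivial
  -- entries number at most `(n+1)^j` per row.
  have hrow : ∀ J : K, ∑ J' : K, e J J' ≤
      (n + 1) ^ j * (n + 1) ^ 2 + m * (n + 1) ^ j * (8 * p * (n + 1)) := by
    intro J
    have h1 : ∀ J' : K, e J J' ≤
        (if ∑ i, J'.1 i = ∑ i, J.1 i then ((n : ℝ) + 1) ^ 2 else 0) + 8 * p * (n + 1) := by
      intro J'
      have h2 : (0 : ℝ) ≤ 8 * p * (n + 1) := by positivity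
      have h3 : (0 : ℝ) ≤ ((n : ℝ) + 1) ^ 2 := by positivity
      simp only [he, eq_comm (a := ∑ i, J.1 i)]
      split_ifs <;> linarith
    refine (sum_le_sum fun J' _ => h1 J').trans ?_
    rw [sum_add_distrib]
    refine add_le_add ?_ ?_
    · rw [sum_coe_sort K fun J' => if ∑ i, J' i = ∑ i, J.1 i then ((n : ℝ) + 1) ^ 2 else 0,
        ← sum_filter, sum_const, nsmul_eq_mul]
      have h5 : (#(K.filter fun J' => ∑ i, J' i = ∑ i, J.1 i) : ℝ) ≤ (n + 1) ^ j := by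
        exact_mod_cast hfib _
      gcongr
    · simp only [sum_const, card_univ, Fintype.card_coe, nsmul_eq_mul]
      gcongr
  have htot : ∑ J : K, ∑ J' : K, e J J' ≤
      m * (n + 1) ^ (2 * j) * ((n + 1) ^ 2 + m * (8 * p * (n + 1))) := by
    calc _ ≤ ∑ _J : K, (((n : ℝ) + 1) ^ j * (n + 1) ^ 2 +
          m * (n + 1) ^ j * (8 * p * (n + 1))) := sum_le_sum fun J _ => hrow J
      _ = #K * (((n : ℝ) + 1) ^ j * (n + 1) ^ 2 + m * (n + 1) ^ j * (8 * p * (n + 1))) := by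
          simp [mul_add]
      _ ≤ m * (n + 1) ^ j * (((n : ℝ) + 1) ^ j * (n + 1) ^ 2 +
          m * (n + 1) ^ j * (8 * p * (n + 1))) := by gcongr
      _ = _ := by rw [two_mul j, pow_add]; ring
  have h2 : MomentLE (fun ω => bracketNorm f K (n + 1) s k ω ^ 2) (2 * p)
      (√(m * (n + 1) ^ (2 * j) * ((n + 1) ^ 2 + m * (8 * p * (n + 1)))) ^ 2) := by
    rw [Real.sq_sqrt (by positivity)]
    refine hsum.mono (fun ω => sq_nonneg _) (fun ω => le_of_eq ?_) htot
    rw [bracketNorm, gramNorm_sq]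
  have h3 := h2.of_pow (fun ω => gramNorm_nonneg _ _) (Real.sqrt_nonneg _)
  rwa [show 2 * (2 * p) = 4 * p by ring] at h3

/-- The sum over the coordinates strictly between the `k`-th and the last one. -/
lemma moment_bracketNorm_of_const_below (hf : IsRFamily τ f) {k l : Fin d} (hl : (l : ℕ) + 1 = d)
    (hk : k < l) {j : ℕ} (hj : (k : ℕ) = j + 1) {p : ℕ} (hp : p ≠ 0) {m : ℝ} (hm : (#I : ℝ) ≤ m)
    (c : ℕ) : ∀ i : ℕ, (k : ℕ) < i → i + c = l → ∀ s ⊆ block d n I,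
      (∀ r ∈ s, ∀ r' ∈ s, ∀ a : Fin d, k < a → (a : ℕ) < i → r a = r' a) →
      MomentLE (bracketNorm f ((block d n I).image (trunc k)) (n + 1) s k) (4 * p)
        ((16 * p * (n + 1)) ^ c *
          √(m * (n + 1) ^ (2 * j) * ((n + 1) ^ 2 + m * (8 * p * (n + 1))))) := by
  induction c with
  | zero =>
    intro i hki hil s hs hconst
    rw [pow_zero, one_mul]
    exact moment_bracketNorm_of_const hf hs hl hk hj
      (fun r hr r' hr' a ha hal => hconst r hr r' hr' a ha (by rw [Fin.lt_def] at hal; omega)) hp hm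
  | succ c ih =>
    intro i hki hil s hs hconst
    set a : Fin d := ⟨i, by omega⟩ with ha
    set K := (block d n I).image (trunc (k : ℕ)) with hK
    set S := √(m * (n + 1) ^ (2 * j) * ((n + 1) ^ 2 + m * (8 * p * (n + 1))))
    -- Slicing by the value of coordinate `a` writes the matrix as a sum of `n + 1` flip
    -- differences, each with one more constant coordinate; this costs `8 · 2p · (n+1)`.
    have h1 := MomentLE.gramNorm_of_flipDiff (τ := τ a) (t := range (n + 1)) (k := 2 * p)
      (V := fun v (J : K) b => cell f (s.filter fun r => r a = v) k J b)
      (fun v J b => IsFlipDiff.sum fun r hr => by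
        have h2 := hf.flipDiff r a
        rwa [(mem_filter.1 (mem_filter.1 hr).1).2] at h2) (by omega)
      (B := fun _ => (16 * p * (n + 1)) ^ c * S) (n + 1) (fun v _ => by
        have h2 := ih (i + 1) (by omega) (by omega) (s.filter fun r => r a = v)
          ((filter_subset _ _).trans hs) (fun r hr r' hr' x hx hxi => by
            rw [mem_filter] at hr hr'
            rcases Nat.lt_succ_iff_lt_or_eq.1 hxi with h3 | h3
            · exact hconst r hr.1 r' hr'.1 x hx h3
            · rw [show x = a from Fin.ext h3, hr.2, hr'.2])
        rw [show 2 * (2 * p) = 4 * p by ring]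
        exact h2)
    rw [show 2 * (2 * p) = 4 * p by ring] at h1
    refine h1.mono (fun ω => gramNorm_nonneg _ _) (fun ω => le_of_eq ?_) (le_of_eq ?_)
    · rw [bracketNorm]
      congr 1
      ext J b
      simp only [cell]
      rw [← sum_fiberwise_of_maps_to (s := s.filter fun r => trunc (k : ℕ) r = J ∧ r k = b)
        (t := range (n + 1)) (g := fun r => r a)
        fun r hr => mem_range.2 (lt_of_mem_block (hs (mem_filter.1 hr).1) a)]
      refine sum_congr rfl fun v _ => sum_congr ?_ fun _ _ => rfl
      rw [filter_filter, filter_filter]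
      exact filter_congr fun r _ => and_comm
    · rw [sum_const, card_range, nsmul_eq_mul, pow_succ]
      push_cast
      ring

lemma moment_bracketNorm (hf : IsRFamily τ f) {k l : Fin d} (hl : (l : ℕ) + 1 = d)
    (hk : k < l) {j : ℕ} (hj : (k : ℕ) = j + 1) {p : ℕ} (hp : p ≠ 0) {m : ℝ} (hm : (#I : ℝ) ≤ m) :
    MomentLE (bracketNorm f ((block d n I).image (trunc k)) (n + 1) (block d n I) k) (4 * p)
      ((16 * p * (n + 1)) ^ (d - 3 - j) *
        √(m * (n + 1) ^ (2 * j) * ((n + 1) ^ 2 + m * (8 * p * (n + 1))))) := by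
  have hkl : (k : ℕ) < l := hk
  exact moment_bracketNorm_of_const_below hf hl hk hj hp hm (d - 3 - j) (k + 1) (by omega)
    (by omega) _ Subset.rfl fun r _ r' _ a ha hal => absurd (Fin.lt_def.1 ha) (by omega)

/-- The error terms with `m = 2 (n + 1) / q`. -/
lemma bracket_bound_le {d n p q j : ℕ} (hp : p ≠ 0) (hq : q ≠ 0) (hj : j + 3 ≤ d) :
    (16 * p * ((n : ℝ) + 1)) ^ (d - 3 - j) *
        √((2 * (n + 1) / q : ℝ) * (n + 1) ^ (2 * j) *
          ((n + 1) ^ 2 + (2 * (n + 1) / q) * (8 * p * (n + 1)))) ≤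
      16 ^ d * 3 * (p ^ (d - 3) * √(p * q / (n + 1))) * ((2 * (n + 1) / q) * (n + 1) ^ (d - 2)) := by
  have hp1 : (1 : ℝ) ≤ p := by exact_mod_cast Nat.one_le_iff_ne_zero.2 hp
  have hq1 : (1 : ℝ) ≤ q := by exact_mod_cast Nat.one_le_iff_ne_zero.2 hq
  set x : ℝ := (n : ℝ) + 1 with hx
  have hx0 : 0 < x := by positivity
  set m : ℝ := 2 * x / q with hm
  have hm0 : 0 < m := by positivity
  have hsq : √(m * x ^ (2 * j) * (x ^ 2 + m * (8 * p * x))) ≤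
      3 * (m * x ^ (j + 1)) * √(p * q / x) := by
    refine Real.sqrt_le_iff.2 ⟨by positivity, ?_⟩
    rw [mul_pow, mul_pow, Real.sq_sqrt (by positivity)]
    have h1 : x = q * m / 2 := by rw [hm]; field_simp
    -- Since `x = qm/2`, the equal-sum part is `q m x / 2` and the cancelling part is `8 p m x`;
    -- both are absorbed by `p, q ≥ 1`.
    have h2 : x ^ 2 + m * (8 * p * x) ≤ 9 * (p * q) * (m * x) := by
      have h3 : x ^ 2 = (q * (m * x)) / 2 := by
        calc x ^ 2 = x * x := pow_two x
          _ = (q * m / 2) * x := by rw [← h1]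
          _ = _ := by ring
      have h4 : 0 < m * x := by positivity
      have h5 : (q : ℝ) * (m * x) ≤ p * q * (m * x) := by
        refine mul_le_mul_of_nonneg_right ?_ h4.le
        nlinarith
      have h6 : (p : ℝ) * (m * x) ≤ p * q * (m * x) := by
        refine mul_le_mul_of_nonneg_right ?_ h4.le
        nlinarith
      nlinarith
    calc m * x ^ (2 * j) * (x ^ 2 + m * (8 * p * x)) ≤
          m * x ^ (2 * j) * (9 * (p * q) * (m * x)) := by gcongr
      _ = 3 ^ 2 * (m * x ^ (j + 1)) ^ 2 * (p * q / x) := by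
          field_simp
          ring
  have hpow : (16 * p * x : ℝ) ^ (d - 3 - j) ≤ 16 ^ d * p ^ (d - 3) * x ^ (d - 3 - j) := by
    rw [mul_pow, mul_pow]
    refine mul_le_mul_of_nonneg_right (mul_le_mul (pow_le_pow_right₀ (by norm_num) (by omega))
      (pow_le_pow_right₀ hp1 (by omega)) (by positivity) (by positivity)) (by positivity)
  calc _ ≤ (16 ^ d * p ^ (d - 3) * x ^ (d - 3 - j)) * (3 * (m * x ^ (j + 1)) * √(p * q / x)) :=
        mul_le_mul hpow hsq (Real.sqrt_nonneg _) (by positivity)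
    _ = 16 ^ d * 3 * (p ^ (d - 3) * √(p * q / x)) * (m * (x ^ (d - 3 - j) * x ^ (j + 1))) := by
        ring
    _ = _ := by rw [← pow_add, show d - 3 - j + (j + 1) = d - 2 by omega]

/-! ### Descent through the square functions -/

lemma moment_squareFun_last (hf : IsRFamily τ f) (hd : 3 ≤ d) {m : ℝ} (hm : (#I : ℝ) ≤ m) (p : ℕ) :
    MomentLE (squareFun f (block d n I) (d - 1)) p (m * (n + 1) ^ (d - 2)) := by
  refine MomentLE.of_le (squareFun_nonneg _ _) (fun ω => ?_) p
  have h1 : ∀ J, (∑ r ∈ block d n I with trunc (d - 1) r = J, f r ω) ^ 2 ≤ 1 := by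
    intro J
    rw [← sq_abs]
    refine pow_le_one₀ (abs_nonneg _) (abs_sum_le_one_of_subsingleton (fun r hr r' hr' => ?_)
      fun r => hf.abs_le r ω)
    obtain ⟨hr1, hr2⟩ := mem_filter.1 hr
    obtain ⟨hr1', hr2'⟩ := mem_filter.1 hr'
    refine eq_of_mem_block hr1 hr1' ⟨d - 1, by omega⟩ fun i hi => ?_
    refine trunc_eq_iff.1 (hr2.trans hr2'.symm) i ?_
    have h2 : (i : ℕ) ≠ d - 1 := fun h => hi (Fin.ext h)
    omega
  have h2 : #((block d n I).image (trunc (d - 1))) ≤ #I * (n + 1) ^ (d - 2) := by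
    have := card_image_trunc_le (d := d) (n := n) (I := I) (d - 2)
    rwa [show d - 2 + 1 = d - 1 by omega] at this
  calc squareFun f (block d n I) (d - 1) ω ≤
        ∑ _J ∈ (block d n I).image (trunc (d - 1)), (1 : ℝ) := sum_le_sum fun J _ => h1 J
    _ = #((block d n I).image (trunc (d - 1))) := by simp
    _ ≤ #I * (n + 1) ^ (d - 2) := by exact_mod_cast h2
    _ ≤ _ := by gcongr

lemma moment_squareFun (hf : IsRFamily τ f) (hd : 3 ≤ d) {p q : ℕ} (hp : p ≠ 0) (hq : q ≠ 0)
    (hI : (#I : ℝ) ≤ 2 * (n + 1) / q) (c : ℕ) : ∀ k : ℕ, 1 ≤ k → k + c = d - 1 →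
    MomentLE (squareFun f (block d n I) k) p
      (2 ^ c * ((1 + 768 * 16 ^ d * (p ^ (d - 2) * √(p * q / (n + 1)))) *
        ((2 * (n + 1) / q) * (n + 1) ^ (d - 2)))) := by
  set T : ℝ := (2 * (n + 1) / q) * (n + 1) ^ (d - 2) with hT
  have hp1 : (0 : ℝ) < p := by exact_mod_cast Nat.pos_of_ne_zero hp
  have hq1 : (0 : ℝ) < q := by exact_mod_cast Nat.pos_of_ne_zero hq
  have hT0 : 0 < T := by positivity
  set θ : ℝ := p ^ (d - 2) * √(p * q / (n + 1)) with hθ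
  have hθ0 : 0 < θ := by
    have : (0 : ℝ) < √(p * q / (n + 1)) := Real.sqrt_pos.2 (by positivity)
    positivity
  -- Each descent maps a bound `A` to `2A + E` with the same `E = 768 · 16^d θ T`; the coefficient
  -- `2^c - 1` solves this recursion exactly.
  suffices h : ∀ k : ℕ, 1 ≤ k → k + c = d - 1 → MomentLE (squareFun f (block d n I) k) p
      (2 ^ c * T + (2 ^ c - 1) * (768 * 16 ^ d * θ * T)) by
    intro k hk hkc
    refine (h k hk hkc).mono (squareFun_nonneg _ _) (fun _ => le_rfl) ?_
    have : 0 < 768 * 16 ^ d * θ * T := by positivity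
    linarith
  induction c with
  | zero =>
    intro k _ hkc
    have h1 := moment_squareFun_last (n := n) hf hd hI p
    rw [show k = d - 1 by omega]
    simpa using h1
  | succ c ih =>
    intro k hk hkc
    obtain ⟨j, rfl⟩ := Nat.exists_eq_succ_of_ne_zero (by omega : k ≠ 0)
    have h1 := moment_bracketNorm (n := n) hf (k := ⟨j + 1, by omega⟩) (l := ⟨d - 1, by omega⟩)
      (by simp only; omega) (Fin.lt_def.2 (by simp only; omega)) (j := j) rfl hp hI
    have h2 := h1.mono (fun ω => h1.nonneg ω) (fun _ => le_rfl)
      (bracket_bound_le (d := d) (n := n) hp hq (j := j) (by omega))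
    have h3 := MomentLE.squareFun_of_succ hf (k := ⟨j + 1, by omega⟩) (N := n + 1)
      (fun r hr => lt_of_mem_block hr _) hp
      (by
        have : (0 : ℝ) < √(p * q / (n + 1)) := Real.sqrt_pos.2 (by positivity)
        positivity) (ih (j + 2) (by omega) (by omega)) h2
    refine h3.mono (fun ω => squareFun_nonneg _ _ ω) (fun _ => le_rfl) (le_of_eq ?_)
    have h4 : (p : ℝ) ^ (d - 2) = p * p ^ (d - 3) := by
      rw [← pow_succ']; congr 1; omega
    rw [hθ, h4, pow_succ]
    ring

/-- The moments of the sum of an `r`-family over a block, on a finite probability space. -/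
theorem moment_sum_block (hf : IsRFamily τ f) (hd : 3 ≤ d) {p q : ℕ} (hp : p ≠ 0) (hq : q ≠ 0)
    (hI : (#I : ℝ) ≤ 2 * (n + 1) / q) (hpq : (p : ℝ) ^ (d - 2) * √(p * q / (n + 1)) ≤ 1) :
    MomentLE (fun ω => (∑ r ∈ block d n I, f r ω) ^ 2) p
      (258 * 2 ^ d * (769 * 64 ^ d) * (p * ((2 * (n + 1) / q) * (n + 1) ^ (d - 2)))) := by
  set T : ℝ := (2 * (n + 1) / q) * (n + 1) ^ (d - 2) with hT
  have hp1 : (1 : ℝ) ≤ p := by exact_mod_cast Nat.one_le_iff_ne_zero.2 hp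
  have hq1 : (0 : ℝ) < q := by exact_mod_cast Nat.pos_of_ne_zero hq
  have hT0 : 0 < T := by positivity
  set θ : ℝ := p ^ (d - 2) * √(p * q / (n + 1)) with hθ
  set B : ℝ := 2 ^ d * (769 * 64 ^ d) * T with hB
  -- Needed for `p' = p` and, because of the bracket, for `p' = 4p`; the threshold `4^d`
  -- accommodates both.
  have hsq : ∀ p' : ℕ, p' ≠ 0 → (p' : ℝ) ^ (d - 2) * √(p' * q / (n + 1)) ≤ 4 ^ d →
      MomentLE (squareFun f (block d n I) 1) p' B := by
    intro p' hp' h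
    have h1 := moment_squareFun hf hd hp' hq hI (d - 2) 1 le_rfl (by omega)
    refine h1.mono (squareFun_nonneg _ _) (fun _ => le_rfl) ?_
    have h2 : (2 : ℝ) ^ (d - 2) ≤ 2 ^ d := pow_le_pow_right₀ (by norm_num) (by omega)
    have h3 : (1 : ℝ) ≤ 64 ^ d := one_le_pow₀ (by norm_num)
    have h4 : (64 : ℝ) ^ d = 16 ^ d * 4 ^ d := by rw [← mul_pow]; norm_num
    have h5 : 1 + 768 * 16 ^ d * ((p' : ℝ) ^ (d - 2) * √(p' * q / (n + 1))) ≤ 769 * 64 ^ d := by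
      have := mul_le_mul_of_nonneg_left h (show (0 : ℝ) ≤ 768 * 16 ^ d by positivity)
      rw [mul_assoc 768 (16 ^ d : ℝ) (4 ^ d), ← h4] at this
      linarith
    rw [hB, mul_assoc (2 ^ d : ℝ)]
    gcongr
  have h4 : ((4 * p : ℕ) : ℝ) ^ (d - 2) * √((4 * p : ℕ) * q / (n + 1)) ≤ 4 ^ d := by
    have e1 : √((4 * p : ℕ) * q / (n + 1)) = 2 * √(p * q / (n + 1)) := by
      rw [show (((4 * p : ℕ) : ℝ) * q / (n + 1)) = 2 ^ 2 * (p * q / (n + 1)) by push_cast; ring,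
        Real.sqrt_mul (by norm_num), Real.sqrt_sq (by norm_num)]
    have e2 : (4 : ℝ) ^ d = 4 ^ (d - 2) * 16 := by
      rw [show (16 : ℝ) = 4 ^ 2 by norm_num, ← pow_add]; congr 1; omega
    rw [e1, e2]
    push_cast
    rw [mul_pow]
    calc _ = 4 ^ (d - 2) * (2 * (p ^ (d - 2) * √(p * q / (n + 1)))) := by ring
      _ ≤ 4 ^ (d - 2) * (2 * 1) := by gcongr
      _ ≤ _ := by gcongr; norm_num
  have h1 := hsq p hp (hpq.trans (one_le_pow₀ (by norm_num)))
  have h2 := hsq (4 * p) (by omega) h4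
  -- The only step at which the full factor `p` is paid: the scalar bracket is bounded by the whole
  -- square function in the first coordinate.
  have h3 := MomentLE.squareFun_of_succ hf (k := 0) (N := n + 1)
    (fun r hr => lt_of_mem_block hr 0) hp (B := B) (by positivity) (A := B)
    (by simpa using h1)
    (h2.mono (fun ω => gramNorm_nonneg _ _) (fun ω => by
      simpa using bracketNorm_le (f := f) (k := 0) (fun r hr => lt_of_mem_block hr 0) ω) le_rfl)
  refine h3.mono (fun ω => sq_nonneg _) (fun ω => le_of_eq ?_) ?_
  · rw [Fin.val_zero, squareFun_zero]
  · have hB0 : 0 ≤ B := by positivity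
    calc 2 * B + 256 * p * B ≤ 258 * (p * B) := by nlinarith
      _ = _ := by rw [hB]; ring

end Bracket

/-! ### The finite model of the unit cube -/

section Sample

/-- The Haar function of the `m`-th interval of a level in terms of the index `z` of the dyadic
interval of the next level that contains the argument. -/
def haarNat (m z : ℕ) : ℝ := -(if z = 2 * m then 1 else 0) + if z = 2 * m + 1 then 1 else 0

lemma haarNat_xor_one (m z : ℕ) : haarNat m (z ^^^ 1) = -haarNat m z := by
  rcases Nat.even_or_odd z with h | h
  · rw [Nat.xor_one_of_even h]
    obtain ⟨w, rfl⟩ := h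
    have h1 : (w + w + 1 = 2 * m) ↔ False := iff_false_intro (by omega)
    have h2 : (w + w + 1 = 2 * m + 1) ↔ w = m := by omega
    have h3 : (w + w = 2 * m) ↔ w = m := by omega
    have h4 : (w + w = 2 * m + 1) ↔ False := iff_false_intro (by omega)
    simp [haarNat, h1, h3, h4]
  · rw [Nat.xor_one_of_odd h]
    obtain ⟨w, rfl⟩ := h
    have h1 : (2 * w + 1 - 1 = 2 * m) ↔ w = m := by omega
    have h2 : (2 * w + 1 - 1 = 2 * m + 1) ↔ False := iff_false_intro (by omega)
    have h3 : (2 * w + 1 = 2 * m) ↔ False := iff_false_intro (by omega)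
    have h4 : (2 * w + 1 = 2 * m + 1) ↔ w = m := by omega
    simp only [haarNat, h1, h2, h3, h4]
    simp

lemma abs_haarNat_le (m z : ℕ) : |haarNat m z| ≤ if z / 2 = m then 1 else 0 := by
  rw [haarNat]
  split_ifs with h1 h2 h3 h4 h5 h6 <;> first | omega | norm_num

lemma haarInterval_eq (s m : ℕ) {y : ℝ} (hy : 0 ≤ y) :
    haarInterval s m y = haarNat m ⌊2 ^ (s + 1) * y⌋₊ := by
  have h0 : (0 : ℝ) ≤ 2 ^ (s + 1) * y := by positivity
  have h2 : (0 : ℝ) < 2 ^ s := by positivity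
  rw [haarInterval, haarNat, Set.indicator_apply, Set.indicator_apply]
  congr 2
  · refine if_congr ?_ rfl rfl
    rw [Nat.floor_eq_iff h0, Set.mem_Ico, div_le_iff₀ h2, lt_div_iff₀ h2, pow_succ]
    push_cast
    constructor <;> rintro ⟨h3, h4⟩ <;> constructor <;> linarith
  · rw [Nat.floor_eq_iff h0, Set.mem_Ico, div_le_iff₀ h2, lt_div_iff₀ h2, pow_succ]
    push_cast
    exact propext (by constructor <;> rintro ⟨h3, h4⟩ <;> constructor <;> linarith)

/-- The flip of the `j`-th most significant of the `L` binary digits of a number. -/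
def flipDigit (L j : ℕ) : Equiv.Perm (Fin (2 ^ L)) :=
  Function.Involutive.toPerm
    (fun x => if h : j < L then ⟨x ^^^ 2 ^ (L - (j + 1)), Nat.xor_lt_two_pow x.2
      (Nat.pow_lt_pow_right one_lt_two (by omega))⟩ else x)
    (fun x => by
      by_cases h : j < L
      · simp only [h, dif_pos]
        exact Fin.ext (by simp)
      · simp [h])

lemma flipDigit_of_le {L j : ℕ} (h : L ≤ j) (x : Fin (2 ^ L)) : flipDigit L j x = x := by
  simp [flipDigit, not_lt.2 h]

lemma flipDigit_div_self {L j : ℕ} (h : j < L) (x : Fin (2 ^ L)) :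
    (flipDigit L j x : ℕ) / 2 ^ (L - (j + 1)) = (x / 2 ^ (L - (j + 1))) ^^^ 1 := by
  simp [flipDigit, h, Nat.xor_div_two_pow]

/-- The quotient keeps only the digits up to index `s`, so a flip at a later index is invisible. -/
lemma flipDigit_div_of_lt {L s j : ℕ} (hs : s < j) (x : Fin (2 ^ L)) :
    (flipDigit L j x : ℕ) / 2 ^ (L - (s + 1)) = x / 2 ^ (L - (s + 1)) := by
  by_cases h : j < L
  · have h1 : 2 ^ (L - (j + 1)) / 2 ^ (L - (s + 1)) = 0 :=
      Nat.div_eq_of_lt (Nat.pow_lt_pow_right one_lt_two (by omega))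
    simp [flipDigit, h, Nat.xor_div_two_pow, h1]
  · rw [flipDigit_of_le (not_lt.1 h)]

variable {d : ℕ}

/-- The flip of a digit of the `k`-th coordinate. -/
def flipCoord (L : ℕ) (k : Fin d) (j : ℕ) : Equiv.Perm (Fin d → Fin (2 ^ L)) :=
  Equiv.piCongrRight fun i => if i = k then flipDigit L j else Equiv.refl _

lemma flipCoord_apply_self (L : ℕ) (k : Fin d) (j : ℕ) (ω : Fin d → Fin (2 ^ L)) :
    flipCoord L k j ω k = flipDigit L j (ω k) := by
  simp [flipCoord]

lemma flipCoord_apply_of_ne (L : ℕ) {k i : Fin d} (h : i ≠ k) (j : ℕ) (ω : Fin d → Fin (2 ^ L)) :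
    flipCoord L k j ω i = ω i := by
  simp [flipCoord, h]

/-- The function `f_r` on the finite model; it is `0` if the model is too coarse. -/
def rSample (α : DyadicRect d → ℝ) (L : ℕ) (r : Fin d → ℕ) (ω : Fin d → Fin (2 ^ L)) : ℝ :=
  if ∀ k, r k < L then
    ∑ m : (k : Fin d) → Fin (2 ^ r k), Real.sign (α ⟨r, m⟩) *
      ∏ k, haarNat (m k) (ω k / 2 ^ (L - (r k + 1)))
  else 0

lemma abs_sign_le (x : ℝ) : |Real.sign x| ≤ 1 := by
  rcases Real.sign_apply_eq x with h | h | h <;> simp [h]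

/-- Rectangles of one shape are disjoint, so at most one term survives; the count factors over the
coordinates. -/
lemma abs_sum_sign_le {N : Fin d → ℕ} (β : ((k : Fin d) → Fin (N k)) → ℝ) (z : Fin d → ℕ) :
    |∑ m : (k : Fin d) → Fin (N k), Real.sign (β m) * ∏ k, haarNat (m k) (z k)| ≤ 1 := by
  have h1 : ∀ m : (k : Fin d) → Fin (N k),
      |Real.sign (β m) * ∏ k, haarNat (m k) (z k)| ≤
        ∏ k, if z k / 2 = m k then (1 : ℝ) else 0 := by
    intro m
    rw [abs_mul, abs_prod]
    exact (mul_le_of_le_one_left (prod_nonneg fun k _ => abs_nonneg _) (abs_sign_le _)).trans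
      (prod_le_prod (fun k _ => abs_nonneg _) fun k _ => abs_haarNat_le _ _)
  have h2 := Fintype.prod_sum fun (k : Fin d) (m : Fin (N k)) =>
    if z k / 2 = (m : ℕ) then (1 : ℝ) else 0
  refine (abs_sum_le_sum_abs _ _).trans ((sum_le_sum fun m _ => h1 m).trans ?_)
  rw [← h2]
  refine prod_le_one (fun k _ => sum_nonneg fun m _ => by split_ifs <;> norm_num) fun k _ => ?_
  rw [← sum_filter, sum_const, nsmul_eq_mul, mul_one]
  have h3 : #(univ.filter fun m : Fin (N k) => z k / 2 = (m : ℕ)) ≤ 1 :=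
    card_le_one.2 fun a ha b hb =>
      Fin.ext ((mem_filter.1 ha).2.symm.trans (mem_filter.1 hb).2)
  exact_mod_cast h3

lemma isRFamily_rSample (α : DyadicRect d → ℝ) (L : ℕ) :
    IsRFamily (flipCoord L) (rSample α L) where
  flipDiff r k := by
    by_cases hr : ∀ k, r k < L
    · have hmul : ∀ (j : ℕ) (m : (k : Fin d) → Fin (2 ^ r k)) (ω : Fin d → Fin (2 ^ L)),
          ∏ i, haarNat (m i) (flipCoord L k j ω i / 2 ^ (L - (r i + 1))) =
            haarNat (m k) (flipDigit L j (ω k) / 2 ^ (L - (r k + 1))) *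
              ∏ i ∈ univ.erase k, haarNat (m i) (ω i / 2 ^ (L - (r i + 1))) := by
        intro j m ω
        rw [← mul_prod_erase univ _ (mem_univ k), flipCoord_apply_self]
        congr 1
        refine prod_congr rfl fun i hi => ?_
        rw [flipCoord_apply_of_ne L (ne_of_mem_erase hi)]
      constructor
      · intro ω
        simp only [rSample, if_pos hr, hmul]
        rw [← sum_neg_distrib]
        refine sum_congr rfl fun m _ => ?_
        rw [flipDigit_div_self (hr k), haarNat_xor_one, ← mul_prod_erase univ _ (mem_univ k)]
        ring
      · intro j hj ω
        simp only [rSample, if_pos hr, hmul]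
        refine sum_congr rfl fun m _ => ?_
        rw [flipDigit_div_of_lt hj, ← mul_prod_erase univ _ (mem_univ k)]
    · exact ⟨fun ω => by simp [rSample, hr], fun j _ ω => by simp [rSample, hr]⟩
  abs_le r ω := by
    rw [rSample]
    split_ifs with hr
    · exact abs_sum_sign_le (fun m => α ⟨r, m⟩) _
    · simp

/-- The index of the dyadic interval of length `2⁻ᴸ` which contains a point of `[0, 1)`. -/
def digits (L : ℕ) (y : ℝ) : Fin (2 ^ L) :=
  ⟨⌊2 ^ L * y⌋₊ % 2 ^ L, Nat.mod_lt _ (by positivity)⟩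

lemma measurable_digits (L : ℕ) : Measurable (digits L) := by
  have h : Measurable fun k : ℕ => (⟨k % 2 ^ L, Nat.mod_lt _ (by positivity)⟩ : Fin (2 ^ L)) :=
    measurable_from_top
  exact h.comp (Nat.measurable_floor.comp (measurable_const_mul _))

lemma coe_digits {L : ℕ} {y : ℝ} (hy : y ∈ Set.Ico (0 : ℝ) 1) :
    (digits L y : ℕ) = ⌊2 ^ L * y⌋₊ := by
  refine Nat.mod_eq_of_lt ((Nat.floor_lt (by have := hy.1; positivity)).2 ?_)
  push_cast
  exact mul_lt_of_lt_one_right (by positivity) hy.2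

lemma rFun_eq_rSample (α : DyadicRect d → ℝ) {L : ℕ} {r : Fin d → ℕ} (hr : ∀ k, r k < L)
    {y : Fin d → ℝ} (hy : ∀ k, y k ∈ Set.Ico (0 : ℝ) 1) :
    rFun α r y = rSample α L r fun k => digits L (y k) := by
  rw [rFun, rSample, if_pos hr]
  refine sum_congr rfl fun m _ => ?_
  rw [haar]
  congr 1
  refine prod_congr rfl fun k _ => ?_
  rw [haarInterval_eq _ _ (hy k).1, coe_digits (hy k)]
  congr 1
  have h1 : (2 : ℝ) ^ (r k + 1) * y k = 2 ^ L * y k / (2 ^ (L - (r k + 1)) : ℕ) := by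
    have h2 : (2 : ℝ) ^ L = 2 ^ (r k + 1) * 2 ^ (L - (r k + 1)) := by
      rw [← pow_add]; congr 1; have := hr k; omega
    rw [h2]; push_cast; field_simp
  simp only [h1, Nat.floor_div_natCast]

lemma restrict_map_digits (L : ℕ) (x : Fin (2 ^ L)) :
    ((volume.restrict (Set.Ico (0 : ℝ) 1)).map (digits L)) {x} = (2 ^ L : ENNReal)⁻¹ := by
  rw [Measure.map_apply (measurable_digits L) (measurableSet_singleton x),
    Measure.restrict_apply (measurable_digits L (measurableSet_singleton x))]
  have hpos : (0 : ℝ) < 2 ^ L := by positivity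
  have h1 : digits L ⁻¹' {x} ∩ Set.Ico (0 : ℝ) 1 =
      Set.Ico ((x : ℝ) / 2 ^ L) (((x : ℝ) + 1) / 2 ^ L) := by
    ext y
    have hx : ((x : ℕ) : ℝ) + 1 ≤ 2 ^ L := by exact_mod_cast x.2
    simp only [Set.mem_inter_iff, Set.mem_preimage, Set.mem_singleton_iff, Fin.ext_iff]
    constructor
    · rintro ⟨h1, h2⟩
      rw [coe_digits h2, Nat.floor_eq_iff (by have := h2.1; positivity)] at h1
      rw [Set.mem_Ico, div_le_iff₀ hpos, lt_div_iff₀ hpos]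
      constructor <;> linarith
    · intro h
      have h2 : y ∈ Set.Ico (0 : ℝ) 1 :=
        ⟨le_trans (by positivity) h.1, h.2.trans_le ((div_le_one hpos).2 hx)⟩
      rw [Set.mem_Ico, div_le_iff₀ hpos, lt_div_iff₀ hpos] at h
      refine ⟨?_, h2⟩
      rw [coe_digits h2, Nat.floor_eq_iff (by have := h2.1; positivity)]
      constructor <;> linarith
  rw [h1, Real.volume_Ico, ← sub_div, add_sub_cancel_left, one_div,
    ENNReal.ofReal_inv_of_pos hpos, ENNReal.ofReal_pow (by norm_num), ENNReal.ofReal_ofNat]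

lemma cubeMeasure_eq (d : ℕ) :
    cubeMeasure d = Measure.pi fun _ : Fin d => volume.restrict (Set.Ico (0 : ℝ) 1) := by
  rw [cubeMeasure, ← Measure.restrict_pi_pi, ← volume_pi]
  exact Measure.restrict_congr_set (Measure.univ_pi_Ico_ae_eq_Icc (μ := fun _ : Fin d => volume)
    (f := 0) (g := 1)).symm

instance (d : ℕ) : IsProbabilityMeasure (cubeMeasure d) := by
  rw [cubeMeasure_eq]
  have : IsProbabilityMeasure (volume.restrict (Set.Ico (0 : ℝ) 1)) := ⟨by simp⟩
  infer_instance

lemma ae_mem_Ico (d : ℕ) : ∀ᵐ y ∂(cubeMeasure d), ∀ k, y k ∈ Set.Ico (0 : ℝ) 1 := by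
  have h : cubeMeasure d =
      volume.restrict (Set.univ.pi fun _ : Fin d => Set.Ico (0 : ℝ) 1) := by
    rw [cubeMeasure_eq, ← Measure.restrict_pi_pi, ← volume_pi]
  rw [h]
  filter_upwards [ae_restrict_mem (MeasurableSet.univ_pi fun _ => measurableSet_Ico)] with y hy k
  exact hy k (Set.mem_univ k)

/-- The digit map pushes Lebesgue measure to the uniform measure, which transfers the finite moments
to the cube. -/
lemma lintegral_digits (L : ℕ) (φ : (Fin d → Fin (2 ^ L)) → ENNReal) :
    ∫⁻ y, φ (fun k => digits L (y k)) ∂(cubeMeasure d) =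
      ∑ ω, φ ω * (Fintype.card (Fin d → Fin (2 ^ L)) : ENNReal)⁻¹ := by
  have hm : Measurable fun (y : Fin d → ℝ) (k : Fin d) => digits L (y k) :=
    measurable_pi_lambda _ fun k => (measurable_digits L).comp (measurable_pi_apply k)
  rw [← lintegral_map (Measurable.of_discrete (f := φ)) hm, lintegral_fintype, cubeMeasure_eq,
    Measure.pi_map_pi fun _ => (measurable_digits L).aemeasurable]
  refine sum_congr rfl fun ω _ => ?_
  rw [Measure.pi_singleton]
  simp only [restrict_map_digits]
  simp [ENNReal.inv_pow]

end Sample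

/-! ### Moments and tails of the block sums -/

section Blocks

lemma IsEqualDivision.sum_eq {n q : ℕ} {e : ℕ → ℕ} (h : IsEqualDivision n q e) {k : ℕ}
    (hk : k ≤ q) : ∑ s ∈ range k, (e (s + 1) - e s) = e k := by
  induction k with
  | zero => simp [h.first]
  | succ k ih =>
    have h1 := h.mono k hk
    rw [sum_range_succ, ih (by omega)]
    omega

lemma IsEqualDivision.mul_le {n q t : ℕ} {e : ℕ → ℕ} (h : IsEqualDivision n q e) (ht : t < q) :
    q * (e (t + 1) - e t) ≤ n + q := by
  have h1 : ∑ _s ∈ range q, (e (t + 1) - e t) ≤ ∑ s ∈ range q, ((e (s + 1) - e s) + 1) :=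
    sum_le_sum fun s hs => h.balanced t ht s (mem_range.1 hs)
  simpa [sum_add_distrib, h.sum_eq le_rfl, h.last] using h1

variable {d : ℕ}

lemma aestronglyMeasurable_digits (L : ℕ) (g : (Fin d → Fin (2 ^ L)) → ℝ) :
    AEStronglyMeasurable (fun y => g fun k => digits L (y k)) (cubeMeasure d) :=
  ((Measurable.of_discrete (f := g)).comp (measurable_pi_lambda _ fun k =>
    (measurable_digits L).comp (measurable_pi_apply k))).aestronglyMeasurable

lemma eLpNorm_digits_le {L p : ℕ} {A : ℝ} {g : (Fin d → Fin (2 ^ L)) → ℝ} (hp : p ≠ 0)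
    (h : MomentLE (fun ω => g ω ^ 2) p A) :
    eLpNorm (fun y => g fun k => digits L (y k)) ((2 * p : ℕ) : ENNReal) (cubeMeasure d) ≤
      ENNReal.ofReal √A := by
  have hp' : (0 : ℝ) < (2 * p : ℕ) := by positivity
  have h1 : ∀ ω, ‖g ω‖ₑ ^ ((2 * p : ℕ) : ℝ) = ENNReal.ofReal ((g ω ^ 2) ^ p) := by
    intro ω
    rw [ENNReal.rpow_natCast, Real.enorm_eq_ofReal_abs, ← ENNReal.ofReal_pow (abs_nonneg _),
      pow_mul, sq_abs]
  rw [eLpNorm_eq_lintegral_rpow_enorm_toReal (by simp [hp]) (ENNReal.natCast_ne_top _),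
    ENNReal.toReal_natCast,
    lintegral_digits L fun ω => ‖g ω‖ₑ ^ ((2 * p : ℕ) : ℝ), one_div,
    ENNReal.rpow_inv_le_iff hp', ENNReal.rpow_natCast,
    ← ENNReal.ofReal_pow (Real.sqrt_nonneg _), pow_mul, Real.sq_sqrt h.bound_nonneg]
  have h2 : (Fintype.card (Fin d → Fin (2 ^ L)) : ENNReal)⁻¹ =
      ENNReal.ofReal (Fintype.card (Fin d → Fin (2 ^ L)) : ℝ)⁻¹ := by
    rw [ENNReal.ofReal_inv_of_pos (by exact_mod_cast Fintype.card_pos), ENNReal.ofReal_natCast]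
  simp only [h1, h2]
  rw [← sum_mul, ← ENNReal.ofReal_sum_of_nonneg fun ω _ => by positivity,
    ← ENNReal.ofReal_mul (sum_nonneg fun ω _ => by positivity)]
  refine ENNReal.ofReal_le_ofReal ?_
  have h3 := h.expect_le
  rwa [Fintype.expect_eq_sum_div_card, div_eq_mul_inv] at h3

/-- The constant in the moment bound for the block sums. -/
def momentConst (d : ℕ) : ℝ := √(258 * 2 ^ d * (769 * 64 ^ d) * 2 ^ (d + 1))

lemma two_le_momentConst (d : ℕ) : 2 ≤ momentConst d := by
  refine Real.le_sqrt_of_sq_le ?_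
  have h1 : (1 : ℝ) ≤ 2 ^ d := one_le_pow₀ (by norm_num)
  have h2 : (1 : ℝ) ≤ 64 ^ d := one_le_pow₀ (by norm_num)
  have h3 : (1 : ℝ) ≤ 2 ^ d * 64 ^ d := one_le_mul_of_one_le_of_one_le h1 h2
  have h4 : (1 : ℝ) ≤ 2 ^ d * 64 ^ d * 2 ^ d := one_le_mul_of_one_le_of_one_le h3 h1
  calc (2 : ℝ) ^ 2 ≤ 258 * 769 * 2 * (2 ^ d * 64 ^ d * 2 ^ d) := by linarith
    _ = _ := by ring

lemma blockCount_le {a ε : ℝ} {n : ℕ} (ha : a ≤ 1) : (blockCount a ε n : ℝ) ≤ (n : ℝ) ^ ε := by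
  have h0 : (0 : ℝ) ≤ (n : ℝ) ^ ε := by positivity
  rcases le_or_gt 0 a with h | h
  · exact (Nat.floor_le (by positivity)).trans (mul_le_of_le_one_left h0 ha)
  · rw [blockCount, Nat.floor_of_nonpos (mul_nonpos_of_nonpos_of_nonneg h.le h0)]
    simpa using h0

/-- After squaring, the claim is `p^(2d-3) q ≤ n + 1`; the range of `p` gives `p^(2d-1) ≤ n^(1-2ε)`,
and multiplying by `q ≤ n^ε` leaves `n^(1-ε)`. -/
lemma pow_mul_sqrt_le {n p q : ℕ} {ε : ℝ} (hd : 3 ≤ d) (hn : n ≠ 0) (hp : p ≠ 0) (hε : 0 < ε)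
    (hq : (q : ℝ) ≤ (n : ℝ) ^ ε)
    (hpn : (p : ℝ) ≤ (n : ℝ) ^ ((1 - 2 * ε) / (2 * (d : ℝ) - 1))) :
    (p : ℝ) ^ (d - 2) * √(p * q / (n + 1)) ≤ 1 := by
  have hn1 : (1 : ℝ) ≤ n := by exact_mod_cast Nat.one_le_iff_ne_zero.2 hn
  have hp1 : (1 : ℝ) ≤ p := by exact_mod_cast Nat.one_le_iff_ne_zero.2 hp
  have hd' : (3 : ℝ) ≤ d := by exact_mod_cast hd
  have h1 : (p : ℝ) ^ (2 * d - 1) ≤ (n : ℝ) ^ (1 - 2 * ε) := by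
    refine (pow_le_pow_left₀ (by positivity) hpn _).trans_eq ?_
    rw [← Real.rpow_natCast, ← Real.rpow_mul n.cast_nonneg]
    congr 1
    rw [Nat.cast_sub (by omega)]
    push_cast
    have : (2 * (d : ℝ) - 1) ≠ 0 := by linarith
    field_simp
  have h2 : ((p : ℝ) ^ (d - 2)) ^ 2 * p ≤ (n : ℝ) ^ (1 - 2 * ε) := by
    refine le_trans ?_ h1
    rw [← pow_mul, ← pow_succ]
    exact pow_le_pow_right₀ hp1 (by omega)
  have h3 : ((p : ℝ) ^ (d - 2)) ^ 2 * p * q ≤ n + 1 := by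
    calc _ ≤ (n : ℝ) ^ (1 - 2 * ε) * (n : ℝ) ^ ε := by gcongr
      _ = (n : ℝ) ^ (1 - ε) := by
        rw [← Real.rpow_add (by positivity)]; congr 1; ring
      _ ≤ (n : ℝ) ^ (1 : ℝ) := Real.rpow_le_rpow_of_exponent_le hn1 (by linarith)
      _ ≤ n + 1 := by rw [Real.rpow_one]; linarith
  rw [← abs_of_nonneg (show (0 : ℝ) ≤ (p : ℝ) ^ (d - 2) by positivity), ← Real.sqrt_sq_eq_abs,
    ← Real.sqrt_mul (by positivity), Real.sqrt_le_one, ← mul_div_assoc, div_le_one (by positivity)]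
  linarith

variable [NeZero d]

lemma blockSum_ae_eq (n : ℕ) (α : DyadicRect d → ℝ) (I : Finset ℕ) :
    blockSum n α I =ᵐ[cubeMeasure d]
      fun y => ∑ r ∈ block d n I, rSample α (n + 1) r fun k => digits (n + 1) (y k) := by
  filter_upwards [ae_mem_Ico d] with y hy
  exact sum_congr rfl fun r hr => rFun_eq_rSample α (fun k => lt_of_mem_block hr k) hy

lemma rho_sq (n q : ℕ) : rho d n q ^ 2 = q / (n : ℝ) ^ (d - 1) := by
  have hd : 1 ≤ d := Nat.one_le_iff_ne_zero.2 (NeZero.ne d)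
  rw [rho, mul_pow, Real.sq_sqrt q.cast_nonneg, ← Real.rpow_natCast _ 2,
    ← Real.rpow_mul n.cast_nonneg, div_eq_mul_inv (q : ℝ), ← Real.rpow_natCast _ (d - 1),
    ← Real.rpow_neg n.cast_nonneg]
  congr 2
  push_cast [hd]
  ring

lemma aestronglyMeasurable_rho_blockSum (n q : ℕ) (α : DyadicRect d → ℝ) (I : Finset ℕ) :
    AEStronglyMeasurable (fun x => rho d n q * blockSum n α I x) (cubeMeasure d) :=
  ((aestronglyMeasurable_digits (n + 1) fun ω =>
    ∑ r ∈ block d n I, rSample α (n + 1) r ω).congr (blockSum_ae_eq n α I).symm).const_mul _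

lemma eLpNorm_rho_blockSum_le_nat {n p q : ℕ} {ε : ℝ} (hd : 3 ≤ d) (hn : n ≠ 0) (hp : p ≠ 0)
    (hq0 : q ≠ 0) (hε : 0 < ε) (hε1 : ε < 1) (hq : (q : ℝ) ≤ (n : ℝ) ^ ε)
    (hpn : (p : ℝ) ≤ (n : ℝ) ^ ((1 - 2 * ε) / (2 * (d : ℝ) - 1)))
    (α : DyadicRect d → ℝ) {I : Finset ℕ} (hI : q * #I ≤ n + q) :
    eLpNorm (fun x => rho d n q * blockSum n α I x) ((2 * p : ℕ) : ENNReal) (cubeMeasure d) ≤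
      ENNReal.ofReal (momentConst d * √(p / 2)) := by
  have hn1 : (1 : ℝ) ≤ n := by exact_mod_cast Nat.one_le_iff_ne_zero.2 hn
  have hn0 : (0 : ℝ) < n := by linarith
  have hq0' : (0 : ℝ) < q := by exact_mod_cast Nat.pos_of_ne_zero hq0
  have hqn : (q : ℝ) ≤ n := hq.trans
    ((Real.rpow_le_rpow_of_exponent_le hn1 hε1.le).trans_eq (Real.rpow_one _))
  have hI' : (#I : ℝ) ≤ 2 * (n + 1) / q := by
    rw [le_div_iff₀ hq0']
    have h : (q : ℝ) * #I ≤ n + q := by exact_mod_cast hI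
    linarith
  have h := (moment_sum_block (isRFamily_rSample α (n + 1)) hd hp hq0 hI'
    (pow_mul_sqrt_le hd hn hp hε hq hpn)).const_mul (sq_nonneg (rho d n q))
  have h1 : (fun x => rho d n q * blockSum n α I x) =ᵐ[cubeMeasure d] fun y =>
      (fun ω => rho d n q * ∑ r ∈ block d n I, rSample α (n + 1) r ω)
        fun k => digits (n + 1) (y k) := by
    filter_upwards [blockSum_ae_eq n α I] with y hy
    rw [hy]
  rw [eLpNorm_congr_ae h1]
  simp only [← mul_pow] at h
  refine (eLpNorm_digits_le hp h).trans (ENNReal.ofReal_le_ofReal ?_)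
  rw [momentConst, ← Real.sqrt_mul (by positivity), rho_sq]
  refine Real.sqrt_le_sqrt ?_
  have h2 : ((n : ℝ) + 1) ^ (d - 1) ≤ 2 ^ (d - 1) * (n : ℝ) ^ (d - 1) := by
    rw [← mul_pow]
    exact pow_le_pow_left₀ (by positivity) (by linarith) _
  have h3 : ((n : ℝ) + 1) ^ (d - 1) = (n + 1) * (n + 1) ^ (d - 2) := by
    rw [← pow_succ']; congr 1; omega
  have h4 : (2 : ℝ) ^ (d + 1) = 2 ^ (d - 1) * 4 := by
    rw [show d + 1 = d - 1 + 2 by omega, pow_add]; norm_num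
  have h5 : ((n : ℝ) + 1) ^ (d - 1) / (n : ℝ) ^ (d - 1) ≤ 2 ^ (d - 1) :=
    (div_le_iff₀ (by positivity)).2 h2
  calc _ = 258 * 2 ^ d * (769 * 64 ^ d) * (2 * p) *
        (((n : ℝ) + 1) ^ (d - 1) / (n : ℝ) ^ (d - 1)) := by
        rw [h3]; field_simp
    _ ≤ 258 * 2 ^ d * (769 * 64 ^ d) * (2 * p) * 2 ^ (d - 1) := by gcongr
    _ = _ := by rw [h4]; ring

lemma eLpNorm_rho_blockSum_le {n q : ℕ} {p ε : ℝ} (hd : 3 ≤ d) (hn : n ≠ 0) (hp : 1 ≤ p)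
    (hq0 : q ≠ 0) (hε : 0 < ε) (hε1 : ε < 1) (hq : (q : ℝ) ≤ (n : ℝ) ^ ε)
    (hpn : 2 * p ≤ (n : ℝ) ^ ((1 - 2 * ε) / (2 * (d : ℝ) - 1)))
    (α : DyadicRect d → ℝ) {I : Finset ℕ} (hI : q * #I ≤ n + q) :
    eLpNorm (fun x => rho d n q * blockSum n α I x) (ENNReal.ofReal p) (cubeMeasure d) ≤
      ENNReal.ofReal (momentConst d * √p) := by
  -- Real exponents are dominated by the even integer `2⌈p⌉` on a probability space; the factor 2
  -- cancels the one in `√(p/2)`.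
  have h1 : (⌈p⌉₊ : ℝ) ≤ 2 * p := by
    have := Nat.ceil_lt_add_one (show 0 ≤ p by linarith)
    linarith
  have h2 : p ≤ ⌈p⌉₊ := Nat.le_ceil p
  have h3 : ENNReal.ofReal p ≤ ((2 * ⌈p⌉₊ : ℕ) : ENNReal) := by
    rw [← ENNReal.ofReal_natCast]
    refine ENNReal.ofReal_le_ofReal ?_
    push_cast
    linarith
  refine (eLpNorm_le_eLpNorm_of_exponent_le h3
    (aestronglyMeasurable_rho_blockSum n q α I)).trans
    ((eLpNorm_rho_blockSum_le_nat hd hn (Nat.ceil_pos.2 (by linarith)).ne' hq0 hε hε1 hq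
      (h1.trans hpn) α hI).trans (ENNReal.ofReal_le_ofReal ?_))
  have := two_le_momentConst d
  gcongr
  linarith

lemma measure_lt_le_of_eLpNorm_le {Ω : Type*} [MeasurableSpace Ω] {μ : Measure Ω} {f : Ω → ℝ}
    {p y B : ℝ} (hf : AEStronglyMeasurable f μ) (hp : 0 < p) (hy : 0 < y) (hB : 0 ≤ B)
    (h : eLpNorm f (ENNReal.ofReal p) μ ≤ ENNReal.ofReal B) :
    μ {x | y < |f x|} ≤ ENNReal.ofReal ((B / y) ^ p) := by
  have h1 := meas_ge_le_mul_pow_eLpNorm_enorm μ (by simpa using hp) ENNReal.ofReal_ne_top hf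
    (ENNReal.ofReal_pos.2 hy).ne' (fun h => absurd h ENNReal.ofReal_ne_top)
  rw [ENNReal.toReal_ofReal hp.le, ← ENNReal.mul_rpow_of_nonneg _ _ hp.le] at h1
  have h2 : {x | y < |f x|} ⊆ {x | ENNReal.ofReal y ≤ ‖f x‖ₑ} := fun x hx => by
    rw [Set.mem_ofPred_eq, Real.enorm_eq_ofReal_abs]
    exact ENNReal.ofReal_le_ofReal (le_of_lt hx)
  refine (measure_mono h2).trans (h1.trans ?_)
  rw [← ENNReal.ofReal_rpow_of_nonneg (by positivity) hp.le, div_eq_inv_mul,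
    ENNReal.ofReal_mul (by positivity), ENNReal.ofReal_inv_of_pos hy]
  gcongr

lemma measure_rho_blockSum_le {n q : ℕ} {y ε : ℝ} (hd : 3 ≤ d) (hn : n ≠ 0)
    (hq0 : q ≠ 0) (hε : 0 < ε) (hε1 : ε < 1) (hq : (q : ℝ) ≤ (n : ℝ) ^ ε) (hy : 0 ≤ y)
    (hyn : 2 * (y ^ 2 / (momentConst d * Real.exp 1) ^ 2) ≤
      (n : ℝ) ^ ((1 - 2 * ε) / (2 * (d : ℝ) - 1)))
    (α : DyadicRect d → ℝ) {I : Finset ℕ} (hI : q * #I ≤ n + q) :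
    cubeMeasure d {x | y < |rho d n q * blockSum n α I x|} ≤
      ENNReal.ofReal (3 * Real.exp (-(y ^ 2 / (momentConst d * Real.exp 1) ^ 2))) := by
  have hC := two_le_momentConst d
  have hC0 : 0 < momentConst d := by linarith
  set p := y ^ 2 / (momentConst d * Real.exp 1) ^ 2 with hp
  -- For `p < 1` no moment is available, but the claimed bound exceeds `3/e > 1`. Otherwise `p` is
  -- chosen so that the Chebyshev quotient `momentConst d * √p / y` is exactly `1/e`.
  rcases lt_or_ge p 1 with h | h
  · refine prob_le_one.trans ?_
    rw [← ENNReal.ofReal_one]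
    refine ENNReal.ofReal_le_ofReal ?_
    have h1 : Real.exp (-1) ≤ Real.exp (-p) := Real.exp_le_exp.2 (by linarith)
    have h2 : Real.exp 1 * Real.exp (-1) = 1 := by rw [← Real.exp_add]; simp
    have h3 := Real.exp_one_lt_d9
    have h4 := Real.exp_pos (-1)
    nlinarith
  · have hp0 : 0 < p := by linarith
    have hy0 : 0 < y := by
      refine hy.lt_of_ne fun h0 => ?_
      rw [hp, ← h0] at h
      norm_num at h
    refine (measure_lt_le_of_eLpNorm_le (aestronglyMeasurable_rho_blockSum n q α I) hp0 hy0
      (by positivity) (eLpNorm_rho_blockSum_le hd hn h hq0 hε hε1 hq hyn α hI)).trans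
      (ENNReal.ofReal_le_ofReal ?_)
    have h1 : √p = y / (momentConst d * Real.exp 1) := by
      rw [hp, ← div_pow, Real.sqrt_sq (by positivity)]
    have h2 : momentConst d * √p / y = Real.exp (-1) := by
      rw [h1, Real.exp_neg]; field_simp
    rw [h2, ← Real.exp_mul, neg_one_mul]
    linarith [Real.exp_pos (-p)]

end Blocks

end SmallBall

end

/-! ### The main theorem and its constants -/

theorem mainTheorem8 (d : ℕ) [NeZero d] (hd : 3 ≤ d) :
    ∃ c C : ℝ, 0 < c ∧ c < 1 ∧ 0 < C ∧
      ∀ (ε a : ℝ), 0 < ε → ε < 1 → 0 < a → a ≤ 1 →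
      ∀ (n : ℕ) (e : ℕ → ℕ),
        SmallBall.IsEqualDivision n (SmallBall.blockCount a ε n) e →
      ∀ (α : SmallBall.DyadicRect d → ℝ) (t : ℕ), t < SmallBall.blockCount a ε n →
        (∀ p : ℝ, 1 ≤ p → p ≤ c * (n : ℝ) ^ ((1 - 2 * ε) / (2 * (d : ℝ) - 1)) →
          eLpNorm
              (fun x => SmallBall.rho d n (SmallBall.blockCount a ε n) *
                SmallBall.blockSum n α (Finset.Ioc (e t) (e (t + 1))) x)
              (ENNReal.ofReal p) (SmallBall.cubeMeasure d)
            ≤ ENNReal.ofReal (C * √p)) ∧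
        (∀ y : ℝ, 0 ≤ y → y < c * (n : ℝ) ^ ((1 - 2 * ε) / (4 * (d : ℝ) - 2)) →
          SmallBall.cubeMeasure d
              {x | y < |SmallBall.rho d n (SmallBall.blockCount a ε n) *
                SmallBall.blockSum n α (Finset.Ioc (e t) (e (t + 1))) x|}
            ≤ ENNReal.ofReal (C * Real.exp (-c * y ^ 2))) := by
  have hC := SmallBall.two_le_momentConst d
  have hE : (2 : ℝ) ≤ Real.exp 1 := by linarith [Real.exp_one_gt_d9]
  have hCE : (4 : ℝ) ≤ SmallBall.momentConst d * Real.exp 1 := by nlinarith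
  have hd' : (3 : ℝ) ≤ d := by exact_mod_cast hd
  -- The rate from the optimized Chebyshev bound. It is also at most `1/2`, which makes room for
  -- rounding `p` up to an integer.
  set c : ℝ := 1 / (SmallBall.momentConst d * Real.exp 1) ^ 2 with hc
  have hc0 : 0 < c := by positivity
  have hc1 : c ≤ 1 / 2 := one_div_le_one_div_of_le (by norm_num) (by nlinarith)
  refine ⟨c, SmallBall.momentConst d + 3, hc0, by linarith, by linarith, ?_⟩
  intro ε a hε hε1 _ ha1 n e he α t ht
  have hn : n ≠ 0 := by
    rintro rfl
    simp [SmallBall.blockCount, Real.zero_rpow hε.ne'] at ht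
  have hq0 : SmallBall.blockCount a ε n ≠ 0 := by omega
  have hq := SmallBall.blockCount_le (ε := ε) (n := n) ha1
  have hI : SmallBall.blockCount a ε n * (Finset.Ioc (e t) (e (t + 1))).card ≤
      n + SmallBall.blockCount a ε n := by
    rw [Nat.card_Ioc]
    exact he.mul_le ht
  have hN : (0 : ℝ) ≤ (n : ℝ) ^ ((1 - 2 * ε) / (2 * (d : ℝ) - 1)) := by positivity
  constructor
  · intro p hp hpn
    refine (SmallBall.eLpNorm_rho_blockSum_le hd hn hp hq0 hε hε1 hq (by nlinarith) α hI).trans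
      (ENNReal.ofReal_le_ofReal ?_)
    gcongr
    linarith
  · intro y hy hyn
    have hM : (0 : ℝ) ≤ (n : ℝ) ^ ((1 - 2 * ε) / (4 * (d : ℝ) - 2)) := by positivity
    have hMN : ((n : ℝ) ^ ((1 - 2 * ε) / (4 * (d : ℝ) - 2))) ^ 2 =
        (n : ℝ) ^ ((1 - 2 * ε) / (2 * (d : ℝ) - 1)) := by
      rw [← Real.rpow_natCast, ← Real.rpow_mul n.cast_nonneg]
      congr 1
      have h1 : 2 * (d : ℝ) - 1 ≠ 0 := by linarith
      have h2 : 4 * (d : ℝ) - 2 = 2 * (2 * d - 1) := by ring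
      rw [h2]
      push_cast
      field_simp
    have hyM : y ^ 2 ≤ (n : ℝ) ^ ((1 - 2 * ε) / (2 * (d : ℝ) - 1)) := by
      rw [← hMN]
      exact pow_le_pow_left₀ hy (by nlinarith) 2
    have hyc : y ^ 2 / (SmallBall.momentConst d * Real.exp 1) ^ 2 = c * y ^ 2 := by
      rw [hc]; ring
    have hcy : c * y ^ 2 ≤ 1 / 2 * y ^ 2 := by gcongr
    refine (SmallBall.measure_rho_blockSum_le hd hn hq0 hε hε1 hq hy
      (by rw [hyc]; linarith) α hI).trans (ENNReal.ofReal_le_ofReal ?_)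
    rw [hyc, neg_mul]
    gcongr
    linarith
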